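/- Let $(\Omega,\mathcal G,Q)$ be a probability space with a filtration $(\mathcal F_s)_{s\ge0}$ and a random time $\tau$ with values in $[0,\infty]$. Put $\mathcal H_s=\sigma(1_{\{\tau\le v\}}:v\le s)$ and $\mathcal G_s=\mathcal F_s\vee\mathcal H_s$, and assume (IND): $\bigvee_s\mathcal F_s$ and $\bigvee_s\mathcal H_s$ are independent. Let $r\in\mathbb R$, $B(t,T)=e^{-r(T-t)}$, $0\le t\le T$ and $\nu>1$. Assume that $\tau$ has a deterministic hazard rate $\lambda_s\ge 0$, locally integrable on $[0,\infty)$, that is, $Q(\tau>s)=e^{-\int_0^s\lambda_v\,dv}$ for all $s\ge0$. For a price process $S$ the random time forward starting (RTFS) call with percentage $\alpha=1$ has price $$c(t,T)=\mathbf E^Q[B(t,T)(S_T-S_{\tau\wedge T})^+\mid\mathcal G_t].$$ Contour integrals $\int_{i\nu-\infty}^{i\nu+\infty}$ are taken along the line $\operatorname{Im}z=\nu$, and $\phi_Z(z)=\mathbf E^Q[e^{izZ}]$. **(1) Exponential Lévy dynamics.** Let $X$ be a Lévy process with respect to $(\mathcal F_s)$ with $\mathbf E^Q[e^{\nu X_T}]<\infty$.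 Let $S$ be adapted and positive, with $S_0$ integrable and $S_v=S_u\,e^{r(v-u)+X_v-X_u}$ for $u\le v$, and let $e^{-rs}S_s$ be an $(\mathcal F_s)$-martingale under $Q$. Then $\mathbf E^Q[e^{\nu(X_T-X_u)}]<\infty$ for all $u\le T$, all the integrals below converge absolutely, and almost surely the following hold. * For $0\le u\le T$ and $K>0$, $$\mathbf E^Q[B(u,T)(S_T-K)^+|\mathcal F_u]=e^{-r(T-u)}\frac{K}{2\pi}\int_{i\nu-\infty}^{i\nu+\infty}e^{-iz(\log(S_u/K)+r(T-u))}\frac{\phi_{X_T-X_u}(-z)}{iz-z^2}\,dz.$$ * For $t\le u\le T$ and $\alpha>0$, $$\mathbf E^Q[B(t,T)(S_T-\alpha S_u)^+|\mathcal F_t]=S_te^{-r(T-u)}\frac{\alpha}{2\pi}\int_{i\nu-\infty}^{i\nu+\infty}e^{-iz(-\log\alpha+r(T-u))}\frac{\phi_{X_T-X_u}(-z)}{iz-z^2}\,dz.$$ * The RTFS price is $$c(t,T)=\mathbf E^Q[B(t,T)(S_T-S_\tau)^+|\mathcal G_t]1_{\{0<\tau\le t\}}+1_{\{\tau>t\}}\frac{S_t}{2\pi}\int_{i\nu-\infty}^{i\nu+\infty}\frac1{iz-z^2}\Big[\int_t^Te^{-r(T-u)(1+iz)}\phi_{X_T-X_u}(-z)\lambda_ue^{-\int_t^u\lambda_sds}du\Big]dz.$$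 **(2) Variance Gamma dynamics, constant hazard rate.** Let $\lambda_s\equiv\lambda\ge 0$ be constant, $\mu>0$, $b,c\in\mathbb R$, and assume $1-b\mu\nu-\tfrac12c^2\mu\nu^2>0$. Let $X_s=bY_s+cW_{Y_s}$, where $W$ is a standard Brownian motion and $Y$ an independent Gamma process with mean rate $1$ and variance rate $\mu$, and suppose that $X$ is adapted and $X_v-X_u$ is independent of $\mathcal F_u$ for $u\le v$. Let $\omega=\frac1\mu\log(1-b\mu-\tfrac12\mu c^2)$, and let $S$ be adapted and positive, with $S_0$ integrable and $S_v=S_ue^{(r+\omega)(v-u)+X_v-X_u}$ for $u\le v$. Put $$A(z)=r(1+iz)+i\omega z+\frac1\mu\ln\Big(1+ib\mu z+\frac{c^2\mu z^2}2\Big)-\lambda$$ with the principal logarithm. Then for $u\le T$ and $\operatorname{Im}z=\nu$ we have $\mathbf E^Q[e^{\nu(X_T-X_u)}]<\infty$ and $$\phi_{X_T-X_u}(-z)=e^{-\frac1\mu(T-u)\ln(1+ib\mu z+c^2\mu z^2/2)}.$$ The inner time integral in (1), for the Lévy process $\omega s+X_s$ in place of $X_s$, equals $\lambda e^{-\lambda(T-t)}\,\frac{1-e^{-A(z)(T-t)}}{A(z)}$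 whenever $A(z)\ne0$. Almost surely $$c(t,T)=\mathbf E^Q[B(t,T)(S_T-S_\tau)^+|\mathcal G_t]1_{\{0<\tau\le t\}}+1_{\{\tau>t\}}\frac{S_t}{2\pi}\lambda e^{-\lambda(T-t)}\int_{i\nu-\infty}^{i\nu+\infty}\frac1{iz-z^2}\,\frac{1-e^{-A(z)(T-t)}}{A(z)}\,dz,$$ where the integral converges absolutely (if $A(z)=0$, the quotient $(1-e^{-A(z)(T-t)})/A(z)$ is read as $0$). -/

import Mathlib

open MeasureTheory ProbabilityTheory Filter Topology
open scoped NNReal ENNReal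

namespace RTFS

noncomputable section

variable {Ω : Type*} {m : MeasurableSpace Ω}

/-! ### The random time and the enlarged filtration -/

/-- The filtration `ℋ_t = σ(1_{τ ≤ s} : s ≤ t)` generated by the jump process of a random time
`τ` (which may take the value `∞`). -/
def jumpFiltration (τ : Ω → WithTop ℝ≥0)
    (hτ : ∀ s : ℝ≥0, MeasurableSet[m] {ω | τ ω ≤ (s : WithTop ℝ≥0)}) : Filtration ℝ≥0 m where
  seq t := MeasurableSpace.generateFrom
    {A | ∃ s : ℝ≥0, s ≤ t ∧ A = {ω | τ ω ≤ (s : WithTop ℝ≥0)}}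
  mono' := by
    intro t t' h
    apply MeasurableSpace.generateFrom_mono
    rintro A ⟨s, hs, rfl⟩
    exact ⟨s, hs.trans h, rfl⟩
  le' := by
    intro t
    apply MeasurableSpace.generateFrom_le
    rintro A ⟨s, -, rfl⟩
    exact hτ s

/-- The enlarged filtration `𝒢_t = ℱ_t ∨ ℋ_t`. -/
def enlarged (F : Filtration ℝ≥0 m) (τ : Ω → WithTop ℝ≥0)
    (hτ : ∀ s : ℝ≥0, MeasurableSet[m] {ω | τ ω ≤ (s : WithTop ℝ≥0)}) : Filtration ℝ≥0 m :=
  F ⊔ jumpFiltration τ hτ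

/-- The random time is a stopping time of the enlarged filtration. -/
theorem isStoppingTime_enlarged (F : Filtration ℝ≥0 m) (τ : Ω → WithTop ℝ≥0)
    (hτ : ∀ s : ℝ≥0, MeasurableSet[m] {ω | τ ω ≤ (s : WithTop ℝ≥0)}) :
    IsStoppingTime (enlarged F τ hτ) τ := by
  intro t
  have h : jumpFiltration τ hτ ≤ enlarged F τ hτ := le_sup_right
  exact h t _ (MeasurableSpace.measurableSet_generateFrom ⟨t, le_rfl, rfl⟩)

/-- Hypothesis (IND): the σ-algebras generated by the market filtration `ℱ` and by `ℋ`
are independent. -/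
def IND (F : Filtration ℝ≥0 m) (τ : Ω → WithTop ℝ≥0)
    (hτ : ∀ s : ℝ≥0, MeasurableSet[m] {ω | τ ω ≤ (s : WithTop ℝ≥0)}) (Q : Measure Ω) : Prop :=
  Indep (⨆ t, F t) (⨆ t, jumpFiltration τ hτ t) Q

/-- `lam` is the (deterministic) hazard rate of `τ`: it is nonnegative, locally integrable on
`[0, ∞)`, and `Q(τ ≤ t) = 1 - exp (-∫₀ᵗ lam)`, that is `Q(τ > t) = exp (-∫₀ᵗ lam)`. -/
structure HasHazardRate (τ : Ω → WithTop ℝ≥0) (lam : ℝ → ℝ) (Q : Measure Ω) : Prop where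
  nonneg : ∀ s, 0 ≤ s → 0 ≤ lam s
  integrable : ∀ t, 0 ≤ t → IntervalIntegrable lam volume 0 t
  survival : ∀ t : ℝ≥0, Q {ω | (t : WithTop ℝ≥0) < τ ω} =
    ENNReal.ofReal (Real.exp (-∫ s in (0 : ℝ)..t, lam s))

/-! ### Processes -/

/-- Right-continuous with left limits. -/
def IsCadlagPath (f : ℝ≥0 → ℝ) : Prop :=
  ∀ s, ContinuousWithinAt f (Set.Ici s) s ∧ ∃ l, Tendsto f (𝓝[<] s) (𝓝 l)

/-- `X` is a Lévy process on the filtered space: it is adapted, starts at `0`, its increments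
after `s` are independent of `ℱ_s` and stationary, and its paths are a.s. càdlàg. -/
structure IsLevyProcess (F : Filtration ℝ≥0 m) (X : ℝ≥0 → Ω → ℝ) (Q : Measure Ω) : Prop where
  adapted : StronglyAdapted F X
  zero : ∀ᵐ ω ∂Q, X 0 ω = 0
  indep : ∀ s u, s ≤ u →
    Indep (MeasurableSpace.comap (fun ω => X u ω - X s ω) inferInstance) (F s) Q
  stationary : ∀ s h, IdentDistrib (fun ω => X (s + h) ω - X s ω) (X h) Q Q
  cadlag : ∀ᵐ ω ∂Q, IsCadlagPath fun s => X s ω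

/-- The Gamma process with mean rate `1` and variance rate `μ`: a process with independent
increments such that `Y_u - Y_s` has the Gamma law with shape `(u - s) / μ` and scale `μ`
(that is, rate `1 / μ`), with `Y_0 = 0` and càdlàg paths. -/
structure IsGammaProcess (μ : ℝ) (Y : ℝ≥0 → Ω → ℝ≥0) (Q : Measure Ω) : Prop where
  measurable : ∀ s, Measurable (Y s)
  zero : ∀ᵐ ω ∂Q, Y 0 ω = 0
  indep : HasIndepIncrements (fun s ω => (Y s ω : ℝ)) Q
  law : ∀ s u, s < u →
    HasLaw (fun ω => (Y u ω : ℝ) - Y s ω) (gammaMeasure (((u : ℝ) - s) / μ) (1 / μ)) Q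
  cadlag : ∀ᵐ ω ∂Q, IsCadlagPath fun s => (Y s ω : ℝ)

/-- The Variance Gamma process `X_t = b Y_t + c W_{Y_t}` on the filtered space, with `W` a
standard Brownian motion and `Y` a Gamma process with mean rate `1` and variance rate `μ`,
independent of `W`. The process is adapted and its increments after `s` are independent of the
market information `ℱ_s`. -/
structure IsVarianceGamma (F : Filtration ℝ≥0 m) (X : ℝ≥0 → Ω → ℝ) (b c μ : ℝ)
    (Q : Measure Ω) : Prop where
  adapted : StronglyAdapted F X
  indep : ∀ s u, s ≤ u →
    Indep (MeasurableSpace.comap (fun ω => X u ω - X s ω) inferInstance) (F s) Q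
  subordination : ∃ (Y : ℝ≥0 → Ω → ℝ≥0) (W : ℝ≥0 → Ω → ℝ),
    IsGammaProcess μ Y Q ∧
    (∀ s, Measurable (W s)) ∧ IsBrownianReal W Q ∧
    IndepFun (fun ω s => W s ω) (fun ω s => Y s ω) Q ∧
    ∀ᵐ ω ∂Q, ∀ s, X s ω = b * Y s ω + c * W (Y s ω) ω

/-- The asset price is adapted, positive, integrable at time `0`, and follows the exponential
dynamics `S_u = S_s exp (d (u - s) + X_u - X_s)`, `s ≤ u`, with deterministic drift `d`. -/
structure IsExpPrice (F : Filtration ℝ≥0 m) (X : ℝ≥0 → Ω → ℝ) (d : ℝ)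
    (S : ℝ≥0 → Ω → ℝ) (Q : Measure Ω) : Prop where
  adapted : StronglyAdapted F S
  pos : ∀ᵐ ω ∂Q, 0 < S 0 ω
  integrable : Integrable (S 0) Q
  dynamics : ∀ᵐ ω ∂Q, ∀ s u, s ≤ u →
    S u ω = S s ω * Real.exp (d * ((u : ℝ) - s) + (X u ω - X s ω))

/-! ### Prices (discounting is `B(t,T) = exp (-r (T - t))`) -/

/-- Price at time `u` of a plain vanilla call with strike `K` and maturity `T`. -/
def callPrice (Q : Measure Ω) (F : Filtration ℝ≥0 m) (r : ℝ) (S : ℝ≥0 → Ω → ℝ) (K : ℝ)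
    (u T : ℝ≥0) : Ω → ℝ :=
  Q[fun ω => Real.exp (-r * ((T : ℝ) - u)) * max (S T ω - K) 0 | F u]

/-- Price at time `t` of a forward-start call with percentage `α` and determination time `u`. -/
def forwardStartPrice (Q : Measure Ω) (F : Filtration ℝ≥0 m) (r : ℝ) (S : ℝ≥0 → Ω → ℝ) (α : ℝ)
    (t u T : ℝ≥0) : Ω → ℝ :=
  Q[fun ω => Real.exp (-r * ((T : ℝ) - t)) * max (S T ω - α * S u ω) 0 | F t]

/-- Discounted payoff `B(t,T) (S_T - α S_{τ ∧ T})⁺` of the random time forward-start call. -/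
def rtfsPayoff (r : ℝ) (S : ℝ≥0 → Ω → ℝ) (τ : Ω → WithTop ℝ≥0) (α : ℝ) (t T : ℝ≥0) : Ω → ℝ :=
  fun ω => Real.exp (-r * ((T : ℝ) - t)) * max (S T ω - α * stoppedProcess S τ T ω) 0

/-- Price at time `t` of the random time forward-start call, given the information `G t`. -/
def rtfsPrice (Q : Measure Ω) (G : Filtration ℝ≥0 m) (r : ℝ) (S : ℝ≥0 → Ω → ℝ)
    (τ : Ω → WithTop ℝ≥0) (α : ℝ) (t T : ℝ≥0) : Ω → ℝ :=
  Q[rtfsPayoff r S τ α t T | G t]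

/-- Discounted payoff `B(t,T) (S_T - S_τ)⁺`; only its values on `{τ ≤ t}` matter below. -/
def fixedPayoff (r : ℝ) (S : ℝ≥0 → Ω → ℝ) (τ : Ω → WithTop ℝ≥0) (t T : ℝ≥0) : Ω → ℝ :=
  fun ω => Real.exp (-r * ((T : ℝ) - t)) * max (S T ω - stoppedValue S τ ω) 0

/-- The part of the price on which the strike is already known:
`E[B(t,T) (S_T - S_τ)⁺ | 𝒢_t] 1_{0 < τ ≤ t}`. -/
def fixedStrikePart (Q : Measure Ω) (G : Filtration ℝ≥0 m) (r : ℝ) (S : ℝ≥0 → Ω → ℝ)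
    (τ : Ω → WithTop ℝ≥0) (t T : ℝ≥0) : Ω → ℝ :=
  {ω | 0 < τ ω ∧ τ ω ≤ (t : WithTop ℝ≥0)}.indicator (Q[fixedPayoff r S τ t T | G t])

/-! ### Fourier objects -/

/-- The generalized characteristic function `φ_Z(z) = E[exp (i z Z)]`, `z ∈ ℂ`. -/
def genCharFun (Q : Measure Ω) (Z : Ω → ℝ) (z : ℂ) : ℂ :=
  ∫ ω, Complex.exp (Complex.I * z * (Z ω : ℂ)) ∂Q

/-- The contour integral `∫_{iν-∞}^{iν+∞} f(z) dz`. -/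
def lineIntegral (ν : ℝ) (f : ℂ → ℂ) : ℂ :=
  ∫ x : ℝ, f ((x : ℂ) + (ν : ℂ) * Complex.I)

/-- Absolute convergence of the contour integral `∫_{iν-∞}^{iν+∞} f(z) dz`. -/
def LineIntegrable (ν : ℝ) (f : ℂ → ℂ) : Prop :=
  Integrable fun x : ℝ => f ((x : ℂ) + (ν : ℂ) * Complex.I)

/-- The Fourier kernel `exp (-i z y) φ_Z(-z) / (i z - z²)` of the call price. -/
def callKernel (Q : Measure Ω) (Z : Ω → ℝ) (y : ℝ) (z : ℂ) : ℂ :=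
  Complex.exp (-Complex.I * z * (y : ℂ)) * genCharFun Q Z (-z) / (Complex.I * z - z ^ 2)

/-- The inner time integrand
`exp (-r (T-u) (1 + i z)) φ_{X_T - X_u}(-z) lam_u exp (-∫_t^u lam)`, as a function of `u`. -/
def timeIntegrand (Q : Measure Ω) (X : ℝ≥0 → Ω → ℝ) (r : ℝ) (lam : ℝ → ℝ) (t T : ℝ≥0) (z : ℂ)
    (u : ℝ) : ℂ :=
  Complex.exp (-(r : ℂ) * ((T : ℂ) - (u : ℂ)) * (1 + Complex.I * z)) *
    genCharFun Q (fun ω => X T ω - X u.toNNReal ω) (-z) *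
    ((lam u * Real.exp (-∫ s in (t : ℝ)..u, lam s) : ℝ) : ℂ)

/-- The martingale correction `ω = (1/μ) log (1 - b μ - μ c² / 2)` of the Variance Gamma model. -/
def vgOmega (b c μ : ℝ) : ℝ := 1 / μ * Real.log (1 - b * μ - μ * c ^ 2 / 2)

/-- `log (1 + i b μ z + c² μ z² / 2)`, with the principal complex logarithm. -/
def vgLog (b c μ : ℝ) (z : ℂ) : ℂ :=
  Complex.log (1 + Complex.I * b * μ * z + (c : ℂ) ^ 2 * μ * z ^ 2 / 2)

/-- `A(z) = r (1 + i z) + i ω z + (1/μ) log (1 + i b μ z + c² μ z² / 2) - lam`. -/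
def vgExponent (r b c μ lam : ℝ) (z : ℂ) : ℂ :=
  r * (1 + Complex.I * z) + Complex.I * (vgOmega b c μ : ℂ) * z + 1 / μ * vgLog b c μ z - lam

/-- `(1 / (i z - z²)) (1 - exp (-A(z) (T - t))) / A(z)`. -/
def vgKernel (r b c μ lam : ℝ) (t T : ℝ≥0) (z : ℂ) : ℂ :=
  1 / (Complex.I * z - z ^ 2) *
    ((1 - Complex.exp (-vgExponent r b c μ lam z * ((T : ℂ) - (t : ℂ)))) /
      vgExponent r b c μ lam z)

end

end RTFS

open RTFS

namespace RTFS

/-! ### Independence and product measures -/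

section Indep

variable {Ω Ω' E V : Type*} {m : MeasurableSpace Ω} {m' : MeasurableSpace Ω'}
  {mE : MeasurableSpace E} [NormedAddCommGroup V] {Q : Measure Ω}
  {Y : Ω → Ω'} {Z : Ω → E}

/-! Both models are instances of one abstract setting, `IsExpModel`: a driver with independent,
right-continuous increments, exponential increments of mean one, and `ν`-exponential moments of the
remaining increments bounded uniformly in time. Three facts give the prices there.

Freezing (`condExp_of_indep`): an increment independent of `ℱ_u` is integrated out while the rest is
held fixed. A forward-start payoff is `S_u` times a function of the increment after `u`, so at `u`
it is worth a constant times `S_u`. Since the discounted price is a martingale, at `t` it is worth a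
constant times `S_t` (`forwardStartPrice_ae_eq`).

Fourier inversion: damped by `exp (-ν y)`, the call payoff in the log-price is continuous and
integrable, with integrable transform `1 / (i z - z²)` on the line `Im z = ν`
(`max_exp_sub_one_eq_lineIntegral`). There `|exp (-i z Z)| = exp (ν Z)`, so a finite exponential
moment and the quadratic decay of the kernel permit Fubini.

The random time: on `{t < τ}` the σ-algebra `𝒢_t` has the same traces as `ℱ_t`
(`exists_measurableSet_inter_eq`), so it suffices to integrate over `B ∩ {t < τ}` with `B ∈ ℱ_t`. As
`τ` is independent of the market and has density `λ_u exp (-∫₀ᵘ λ)`, these integrals are averages of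
forward-start prices over the determination time (`setIntegral_rtfsPayoff`). Dividing by the
survival probability at `t` restarts the hazard integral at `t`, and a second Fubini moves the
contour integral outside.

In the Lévy case the moment bounds come from the martingale property. In the Variance Gamma case,
integrating out the Brownian motion and then the Gamma clock gives the real moment generating
function, which continues analytically to a strip. The time integrand is then a single exponential
in `u`. The quotient by `A(z)` is legitimate for almost every point of the contour because the zeros
of the analytic function `A` are isolated when `λ ≠ 0`. -/

theorem _root_.ProbabilityTheory.IndepFun.lintegral_comp_prodMk [IsProbabilityMeasure Q]
    (h : IndepFun Y Z Q) (hY : Measurable Y) (hZ : Measurable Z) {g : Ω' × E → ℝ≥0∞}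
    (hg : Measurable g) :
    ∫⁻ ω, g (Y ω, Z ω) ∂Q = ∫⁻ e, ∫⁻ ω, g (Y ω, e) ∂Q ∂(Q.map Z) := by
  have := Measure.isProbabilityMeasure_map (μ := Q) hZ.aemeasurable
  have := Measure.isProbabilityMeasure_map (μ := Q) hY.aemeasurable
  rw [← lintegral_map hg (hY.prodMk hZ),
    (indepFun_iff_map_prod_eq_prod_map_map hY.aemeasurable hZ.aemeasurable).1 h,
    lintegral_prod_symm' _ hg]
  exact lintegral_congr fun e => lintegral_map (hg.comp measurable_prodMk_right) hY

theorem _root_.ProbabilityTheory.IndepFun.integrable_prod_map [IsProbabilityMeasure Q]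
    (h : IndepFun Y Z Q) (hY : Measurable Y) (hZ : Measurable Z) {g : Ω' × E → V}
    (hg : StronglyMeasurable g) (hint : Integrable (fun ω => g (Y ω, Z ω)) Q) :
    Integrable g ((Q.map Y).prod (Q.map Z)) := by
  rw [← (indepFun_iff_map_prod_eq_prod_map_map hY.aemeasurable hZ.aemeasurable).1 h]
  exact (integrable_map_measure hg.aestronglyMeasurable (hY.prodMk hZ).aemeasurable).2 hint

theorem _root_.ProbabilityTheory.IndepFun.integral_comp_prodMk [NormedSpace ℝ V] [IsProbabilityMeasure Q]
    (h : IndepFun Y Z Q) (hY : Measurable Y) (hZ : Measurable Z) {g : Ω' × E → V}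
    (hg : StronglyMeasurable g) (hint : Integrable (fun ω => g (Y ω, Z ω)) Q) :
    ∫ ω, g (Y ω, Z ω) ∂Q = ∫ e, ∫ ω, g (Y ω, e) ∂Q ∂(Q.map Z) := by
  have := Measure.isProbabilityMeasure_map (μ := Q) hZ.aemeasurable
  have := Measure.isProbabilityMeasure_map (μ := Q) hY.aemeasurable
  rw [← integral_map (hY.prodMk hZ).aemeasurable hg.aestronglyMeasurable,
    (indepFun_iff_map_prod_eq_prod_map_map hY.aemeasurable hZ.aemeasurable).1 h,
    integral_prod_symm _ (h.integrable_prod_map hY hZ hg hint)]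
  exact integral_congr_ae (ae_of_all _ fun e => integral_map hY.aemeasurable
    (hg.comp_measurable measurable_prodMk_right).aestronglyMeasurable)

/-- Freezing: the joint law is a product, so on each set `Y ⁻¹' s` Fubini integrates `Z` out first
and leaves a function of `Y` alone. -/
theorem _root_.ProbabilityTheory.IndepFun.condExp_comp_prodMk [IsProbabilityMeasure Q]
    (h : IndepFun Y Z Q) (hY : Measurable Y) (hZ : Measurable Z) {g : Ω' × E → ℝ}
    (hg : Measurable g) (hint : Integrable (fun ω => g (Y ω, Z ω)) Q) :
    Q[fun ω => g (Y ω, Z ω) | m'.comap Y] =ᵐ[Q] fun ω => ∫ e, g (Y ω, e) ∂(Q.map Z) := by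
  have := Measure.isProbabilityMeasure_map (μ := Q) hZ.aemeasurable
  have := Measure.isProbabilityMeasure_map (μ := Q) hY.aemeasurable
  have hprod := h.integrable_prod_map hY hZ hg.stronglyMeasurable hint
  have hsm : StronglyMeasurable fun y => ∫ e, g (y, e) ∂(Q.map Z) :=
    hg.stronglyMeasurable.integral_prod_right'
  have hI : Integrable (fun ω => ∫ e, g (Y ω, e) ∂(Q.map Z)) Q :=
    hprod.integral_prod_left.comp_measurable hY
  refine (ae_eq_condExp_of_forall_setIntegral_eq hY.comap_le hint (fun s _ _ => hI.integrableOn)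
    ?_ (hsm.comp_measurable (comap_measurable Y)).aestronglyMeasurable).symm
  rintro _ ⟨s, hs, rfl⟩ _
  -- The restriction to `Y ⁻¹' s` becomes a restriction to the rectangle `s × E`, to which the
  -- product law applies.
  have h1 : ∫ ω in Y ⁻¹' s, g (Y ω, Z ω) ∂Q =
      ∫ ω, (s ×ˢ (Set.univ : Set E)).indicator g (Y ω, Z ω) ∂Q := by
    rw [← integral_indicator (hY hs)]
    refine integral_congr_ae (ae_of_all _ fun ω => ?_)
    by_cases hω : Y ω ∈ s <;> simp [hω, Set.indicator]
  rw [h1, ← integral_map (hY.prodMk hZ).aemeasurable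
    (hg.stronglyMeasurable.indicator (hs.prod MeasurableSet.univ)).aestronglyMeasurable,
    (indepFun_iff_map_prod_eq_prod_map_map hY.aemeasurable hZ.aemeasurable).1 h,
    integral_indicator (hs.prod MeasurableSet.univ), setIntegral_prod _ hprod.integrableOn]
  simp only [Measure.restrict_univ]
  exact (setIntegral_map hs hsm.aestronglyMeasurable hY.aemeasurable).symm

end Indep

/-! ### Independence from a sub-σ-algebra -/

section IndepSub

variable {Ω E V : Type*} {mF m : MeasurableSpace Ω} {mE : MeasurableSpace E}
  [NormedAddCommGroup V] [NormedSpace ℝ V] {Q : Measure Ω} {Z : Ω → E}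

/-- A sub-σ-algebra is generated by the identity map from `(Ω, m)` to `(Ω, mF)`. Results on pairs of
random variables then apply to integrands that depend on the scenario in an `mF`-measurable way. -/
theorem indepFun_id_of_indep (h : Indep mF (mE.comap Z) Q) :
    @IndepFun Ω Ω E m mF mE id Z Q := by
  refine (@IndepFun_iff_Indep Ω Ω E m mF mE id Z Q).2 ?_
  rwa [MeasurableSpace.comap_id]

theorem integral_of_indep [IsProbabilityMeasure Q] (hle : mF ≤ m) (hZ : Measurable[m] Z)
    (h : Indep mF (mE.comap Z) Q) {g : Ω × E → V}
    (hg : StronglyMeasurable[mF.prod mE] g) (hint : Integrable (fun ω => g (ω, Z ω)) Q) :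
    ∫ ω, g (ω, Z ω) ∂Q = ∫ e, ∫ ω, g (ω, e) ∂Q ∂(Q.map Z) :=
  @IndepFun.integral_comp_prodMk Ω Ω E V m mF mE _ Q id Z _ _ (indepFun_id_of_indep h)
    (measurable_id'' hle) hZ g hg hint

theorem condExp_of_indep [IsProbabilityMeasure Q] (hle : mF ≤ m) (hZ : Measurable[m] Z)
    (h : Indep mF (mE.comap Z) Q) {g : Ω × E → ℝ} (hg : Measurable[mF.prod mE] g)
    (hint : Integrable (fun ω => g (ω, Z ω)) Q) :
    Q[fun ω => g (ω, Z ω) | mF] =ᵐ[Q] fun ω => ∫ e, g (ω, e) ∂(Q.map Z) := by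
  have := @IndepFun.condExp_comp_prodMk Ω Ω E m mF mE Q id Z _ (indepFun_id_of_indep h)
    (measurable_id'' hle) hZ g hg hint
  rwa [MeasurableSpace.comap_id] at this

end IndepSub

/-! ### Jointly measurable versions of right-continuous processes -/

section RightContinuous

/-- The smallest multiple of `1 / (n + 1)` that is larger than `s`. -/
noncomputable def rightGrid (n : ℕ) (s : ℝ≥0) : ℝ≥0 := (⌊(n + 1) * s⌋₊ + 1) / (n + 1)

theorem lt_rightGrid (n : ℕ) (s : ℝ≥0) : s < rightGrid n s := by
  rw [rightGrid, lt_div_iff₀ (by positivity), mul_comm]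
  exact Nat.lt_floor_add_one _

theorem rightGrid_le (n : ℕ) (s : ℝ≥0) : rightGrid n s ≤ s + 1 / (n + 1) := by
  have h : (s + 1 / ((n : ℝ≥0) + 1)) * (n + 1) = (n + 1) * s + 1 := by
    field_simp
  rw [rightGrid, div_le_iff₀ (by positivity), h]
  gcongr
  exact Nat.floor_le (by positivity)

theorem tendsto_rightGrid (s : ℝ≥0) : Tendsto (fun n => rightGrid n s) atTop (𝓝[≥] s) := by
  refine tendsto_nhdsWithin_iff.2 ⟨?_, Eventually.of_forall fun n => (lt_rightGrid n s).le⟩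
  have h : Tendsto (fun n : ℕ => s + 1 / ((n : ℝ≥0) + 1)) atTop (𝓝 s) := by
    simpa using tendsto_const_nhds.add (tendsto_one_div_add_atTop_nhds_zero_nat (𝕜 := ℝ≥0))
  exact tendsto_of_tendsto_of_tendsto_of_le_of_le tendsto_const_nhds h
    (fun n => (lt_rightGrid n s).le) fun n => rightGrid_le n s

variable {Ω : Type*}

/-- The right-continuous version of a process, as a function of time and scenario. -/
noncomputable def rightVersion (Z : ℝ≥0 → Ω → ℝ) (p : ℝ≥0 × Ω) : ℝ :=
  limsup (fun n => Z (rightGrid n p.1) p.2) atTop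

/-- Each grid has countably many points, so every approximant is jointly measurable although `Z`
itself need not be. The σ-algebra on `Ω` is arbitrary, which allows the use of `⨆ t, F t` and of
path space later. -/
theorem measurable_rightVersion [MeasurableSpace Ω] {Z : ℝ≥0 → Ω → ℝ}
    (hZ : ∀ s, Measurable (Z s)) : Measurable (rightVersion Z) := by
  unfold rightVersion
  refine Measurable.limsup fun n => ?_
  have h1 : Measurable fun q : ℕ × Ω => Z ((q.1 + 1) / (n + 1)) q.2 :=
    measurable_from_prod_countable_right fun k => hZ (((k : ℝ≥0) + 1) / (n + 1))
  have h2 : Measurable fun p : ℝ≥0 × Ω => (⌊(n + 1) * p.1⌋₊, p.2) :=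
    (Nat.measurable_floor.comp (measurable_fst.const_mul _)).prodMk measurable_snd
  have h3 := h1.comp h2
  exact h3

theorem rightVersion_eq {Z : ℝ≥0 → Ω → ℝ} {ω : Ω} {s : ℝ≥0}
    (h : ContinuousWithinAt (fun s => Z s ω) (Set.Ici s) s) : rightVersion Z (s, ω) = Z s ω :=
  (h.tendsto.comp (tendsto_rightGrid s)).limsup_eq

end RightContinuous

/-! ### The Fourier kernel of the call payoff -/

section Fourier

variable {ν : ℝ}

/-- The denominator factors as `z (i - z)`, and on the line both factors have squared modulus at
least `x² + (ν - 1)²`. -/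
theorem norm_inv_fourier_denominator_le (hν : 1 < ν) (x : ℝ) :
    ‖1 / (Complex.I * ((x : ℂ) + ν * Complex.I) - ((x : ℂ) + ν * Complex.I) ^ 2)‖ ≤
      1 / (x ^ 2 + (ν - 1) ^ 2) := by
  have hpos : 0 < x ^ 2 + (ν - 1) ^ 2 := by nlinarith [sq_nonneg x]
  rw [norm_div, norm_one]
  refine one_div_le_one_div_of_le hpos ?_
  refine le_of_sq_le_sq ?_ (norm_nonneg _)
  rw [Complex.sq_norm, Complex.normSq_apply]
  have h1 : (Complex.I * ((x : ℂ) + ν * Complex.I) - ((x : ℂ) + ν * Complex.I) ^ 2).re =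
      ν ^ 2 - ν - x ^ 2 := by simp [pow_two]; ring
  have h2 : (Complex.I * ((x : ℂ) + ν * Complex.I) - ((x : ℂ) + ν * Complex.I) ^ 2).im =
      x * (1 - 2 * ν) := by simp [pow_two]; ring
  rw [h1, h2]
  -- The difference of the two squares is `(x² + (ν - 1)²) (2 ν - 1)`.
  nlinarith [mul_nonneg hpos.le (by linarith : (0 : ℝ) ≤ 2 * ν - 1)]

theorem fourier_denominator_ne_zero (hν : 1 < ν) (x : ℝ) :
    Complex.I * ((x : ℂ) + ν * Complex.I) - ((x : ℂ) + ν * Complex.I) ^ 2 ≠ 0 := by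
  have h : Complex.I * ((x : ℂ) + ν * Complex.I) - ((x : ℂ) + ν * Complex.I) ^ 2 =
      ((x : ℂ) + ν * Complex.I) * (Complex.I - ((x : ℂ) + ν * Complex.I)) := by ring
  rw [h]
  refine mul_ne_zero (fun h => ?_) (fun h => ?_)
  · have := congrArg Complex.im h
    simp at this
    linarith
  · have := congrArg Complex.im h
    simp at this
    linarith

theorem continuous_inv_fourier_denominator (hν : 1 < ν) : Continuous fun x : ℝ =>
    1 / (Complex.I * ((x : ℂ) + ν * Complex.I) - ((x : ℂ) + ν * Complex.I) ^ 2) :=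
  continuous_const.div (by fun_prop) fun x => fourier_denominator_ne_zero hν x

theorem lineIntegrable_inv_fourier_denominator (hν : 1 < ν) :
    LineIntegrable ν fun z => 1 / (Complex.I * z - z ^ 2) := by
  have hd : 0 < (ν - 1) ^ 2 := by nlinarith
  have hd' : ν - 1 ≠ 0 := by linarith
  have hi : Integrable (fun x : ℝ => (1 + 1 / (ν - 1) ^ 2) * (1 + x ^ 2)⁻¹) :=
    integrable_inv_one_add_sq.const_mul _
  refine hi.mono' (continuous_inv_fourier_denominator hν).aestronglyMeasurable
    (ae_of_all _ fun x => (norm_inv_fourier_denominator_le hν x).trans ?_)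
  have hpos : 0 < x ^ 2 + (ν - 1) ^ 2 := by positivity
  rw [div_le_iff₀ hpos]
  have h1 : (1 + 1 / (ν - 1) ^ 2) * (1 + x ^ 2)⁻¹ * (x ^ 2 + (ν - 1) ^ 2) =
      ((x ^ 2 + (ν - 1) ^ 2) + (x ^ 2 / (ν - 1) ^ 2 + 1)) / (1 + x ^ 2) := by
    field_simp
  rw [h1, le_div_iff₀ (by positivity)]
  have : 0 ≤ x ^ 2 / (ν - 1) ^ 2 := by positivity
  nlinarith [sq_nonneg x]

/-- The kernel supplies all the decay, so the other factor of a contour integrand need only be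
bounded on the line. -/
theorem lineIntegrable_inv_fourier_denominator_mul (hν : 1 < ν) {f : ℂ → ℂ} {C : ℝ}
    (hf : AEStronglyMeasurable (fun x : ℝ => f ((x : ℂ) + ν * Complex.I)))
    (hC : ∀ x : ℝ, ‖f ((x : ℂ) + ν * Complex.I)‖ ≤ C) :
    LineIntegrable ν fun z => 1 / (Complex.I * z - z ^ 2) * f z :=
  (lineIntegrable_inv_fourier_denominator hν).mul_bdd hf (ae_of_all _ hC)

/-- The call payoff in the log-price, damped by `exp (-ν u)`. -/
noncomputable def dampedCall (ν u : ℝ) : ℂ :=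
  ((Real.exp (-ν * u) * max (Real.exp u - 1) 0 : ℝ) : ℂ)

theorem continuous_dampedCall (ν : ℝ) : Continuous (dampedCall ν) := by
  unfold dampedCall
  fun_prop

theorem dampedCall_eq_indicator (ν : ℝ) : dampedCall ν = (Set.Ioi 0).indicator fun u : ℝ =>
    Complex.exp ((1 - ν : ℂ) * u) - Complex.exp ((-ν : ℂ) * u) := by
  ext u
  rw [dampedCall]
  by_cases hu : u ∈ Set.Ioi 0
  · rw [Set.indicator_of_mem hu, max_eq_left (by linarith [Real.one_le_exp (le_of_lt hu)]), mul_sub,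
      mul_one, ← Real.exp_add]
    push_cast
    ring_nf
  · rw [Set.indicator_of_notMem hu, max_eq_right, mul_zero, Complex.ofReal_zero]
    have : Real.exp u ≤ 1 := Real.exp_le_one_iff.2 (not_lt.1 hu)
    linarith

theorem integrable_dampedCall (hν : 1 < ν) : Integrable (dampedCall ν) := by
  rw [dampedCall_eq_indicator]
  refine IntegrableOn.integrable_indicator (Integrable.sub ?_ ?_) measurableSet_Ioi
  · exact integrableOn_exp_mul_complex_Ioi (by simpa using hν) 0
  · exact integrableOn_exp_mul_complex_Ioi (by simp; linarith) 0

open FourierTransform in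
-- With `z = -2πξ + iν` the transform is `∫₀^∞ (exp ((1 + i z) u) - exp (i z u)) du`. Both exponents
-- have negative real part since `ν > 1`, and the value is `1 / (i z (1 + i z))`.
theorem fourier_dampedCall (hν : 1 < ν) (ξ : ℝ) : 𝓕 (dampedCall ν) ξ =
    1 / (Complex.I * (((-2 * Real.pi * ξ : ℝ) : ℂ) + ν * Complex.I) -
      (((-2 * Real.pi * ξ : ℝ) : ℂ) + ν * Complex.I) ^ 2) := by
  set z : ℂ := ((-2 * Real.pi * ξ : ℝ) : ℂ) + ν * Complex.I with hz
  have hzre : (Complex.I * z).re = -ν := by simp [hz]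
  have hI := Complex.I_sq
  have h1 : 𝓕 (dampedCall ν) ξ = ∫ u in Set.Ioi (0 : ℝ),
      (Complex.exp ((1 + Complex.I * z) * u) - Complex.exp ((Complex.I * z) * u)) := by
    rw [Real.fourier_eq', ← integral_indicator measurableSet_Ioi]
    refine integral_congr_ae (ae_of_all _ fun u => ?_)
    simp only [dampedCall_eq_indicator, smul_eq_mul]
    by_cases hu : u ∈ Set.Ioi 0
    · rw [Set.indicator_of_mem hu, Set.indicator_of_mem hu, mul_sub, ← Complex.exp_add,
        ← Complex.exp_add]
      congr 2 <;>
      · simp [hz]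
        linear_combination (-ν * u : ℂ) * hI
    · rw [Set.indicator_of_notMem hu, Set.indicator_of_notMem hu, mul_zero]
  have ha : (1 + Complex.I * z).re < 0 := by rw [Complex.add_re, hzre]; simpa using hν
  have hb : (Complex.I * z).re < 0 := by rw [hzre]; linarith
  have ha0 : 1 + Complex.I * z ≠ 0 := fun h => by simp [h] at ha
  have hb0 : Complex.I * z ≠ 0 := fun h => by rw [h] at hb; simp at hb
  have hz0 : z ≠ 0 := fun h => hb0 (by rw [h, mul_zero])
  rw [h1, integral_sub (integrableOn_exp_mul_complex_Ioi ha 0)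
    (integrableOn_exp_mul_complex_Ioi hb 0), integral_exp_mul_complex_Ioi ha,
    integral_exp_mul_complex_Ioi hb]
  simp only [Complex.ofReal_zero, mul_zero, Complex.exp_zero]
  have hd : Complex.I * z - z ^ 2 = (Complex.I * z) * (1 + Complex.I * z) := by
    linear_combination (-z ^ 2) * hI
  rw [hd]
  field_simp
  ring

open FourierTransform in
-- Fourier inversion holds at every `y`, the damped payoff being continuous and integrable with
-- integrable transform. Multiplying by `exp (ν y)` undoes the damping and moves the integration to
-- `Im z = ν`.
theorem max_exp_sub_one_eq_lineIntegral (hν : 1 < ν) (y : ℝ) :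
    ((max (Real.exp y - 1) 0 : ℝ) : ℂ) = 1 / (2 * Real.pi) *
      lineIntegral ν fun z => Complex.exp (-Complex.I * z * y) / (Complex.I * z - z ^ 2) := by
  set k : ℝ → ℂ := fun x =>
    1 / (Complex.I * ((x : ℂ) + ν * Complex.I) - ((x : ℂ) + ν * Complex.I) ^ 2) with hk
  have hkint : Integrable k := lineIntegrable_inv_fourier_denominator hν
  have hF : 𝓕 (dampedCall ν) = fun ξ => k (-2 * Real.pi * ξ) :=
    funext fun ξ => fourier_dampedCall hν ξ
  have hpi : -2 * Real.pi ≠ 0 := by simp [Real.pi_ne_zero]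
  have hinv := congrFun ((continuous_dampedCall ν).fourierInv_fourier_eq (integrable_dampedCall hν)
    (by rw [hF]; exact hkint.comp_mul_left' hpi)) y
  rw [hF, Real.fourierInv_eq'] at hinv
  have h2 : (∫ v : ℝ, Complex.exp (↑(2 * Real.pi * inner ℝ v y) * Complex.I) •
      k (-2 * Real.pi * v)) =
      ∫ v : ℝ, (fun x : ℝ => Complex.exp (-Complex.I * x * y) * k x) (-2 * Real.pi * v) := by
    refine integral_congr_ae (ae_of_all _ fun v => ?_)
    simp only [smul_eq_mul]
    congr 2
    simp
    ring
  -- The substitution `x = -2πv` has Jacobian `2π`, whence the prefactor.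
  rw [h2, Measure.integral_comp_mul_left (fun x : ℝ => Complex.exp (-Complex.I * x * y) * k x)]
    at hinv
  have h3 : ((max (Real.exp y - 1) 0 : ℝ) : ℂ) = Complex.exp (ν * y) * dampedCall ν y := by
    rw [dampedCall]
    push_cast
    rw [← mul_assoc, ← Complex.exp_add]
    simp
  rw [h3, ← hinv, lineIntegral, abs_inv, abs_mul, abs_neg, abs_two, abs_of_pos Real.pi_pos,
    Complex.real_smul, mul_left_comm, ← integral_const_mul]
  push_cast
  rw [one_div]
  congr 1
  refine integral_congr_ae (ae_of_all _ fun x => ?_)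
  simp only [hk]
  rw [← mul_assoc, ← Complex.exp_add, mul_one_div]
  congr 2
  linear_combination (ν * y : ℂ) * Complex.I_sq

end Fourier

/-! ### Expectation under the contour integral -/

section CallKernel

variable {Ω : Type*} {m : MeasurableSpace Ω} {Q : Measure Ω} {Z : Ω → ℝ} {ν : ℝ}

theorem norm_exp_I_mul_neg_line (x z : ℝ) :
    ‖Complex.exp (Complex.I * -((x : ℂ) + ν * Complex.I) * z)‖ = Real.exp (ν * z) := by
  rw [Complex.norm_exp]
  simp

/-- No integrability is assumed: if `exp (ν Z)` is not integrable, both Bochner integrals are zero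
by convention. -/
theorem norm_genCharFun_line_le (x : ℝ) :
    ‖genCharFun Q Z (-((x : ℂ) + ν * Complex.I))‖ ≤ ∫ ω, Real.exp (ν * Z ω) ∂Q := by
  refine (norm_integral_le_integral_norm _).trans_eq ?_
  simp only [norm_exp_I_mul_neg_line]

theorem stronglyMeasurable_genCharFun_line [SFinite Q] (hZ : Measurable Z) :
    StronglyMeasurable fun x : ℝ => genCharFun Q Z (-((x : ℂ) + ν * Complex.I)) := by
  unfold genCharFun
  refine StronglyMeasurable.integral_prod_right
    (f := fun (x : ℝ) ω => Complex.exp (Complex.I * -((x : ℂ) + ν * Complex.I) * (Z ω : ℂ))) ?_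
  refine Measurable.stronglyMeasurable ?_
  fun_prop

theorem callKernel_eq (y : ℝ) (z : ℂ) : callKernel Q Z y z =
    1 / (Complex.I * z - z ^ 2) * (Complex.exp (-Complex.I * z * y) * genCharFun Q Z (-z)) := by
  rw [callKernel]
  ring

theorem norm_exp_neg_I_mul_line (x y : ℝ) :
    ‖Complex.exp (-Complex.I * ((x : ℂ) + ν * Complex.I) * y)‖ = Real.exp (ν * y) := by
  rw [Complex.norm_exp]
  simp

theorem lineIntegrable_callKernel [SFinite Q] (hν : 1 < ν) (hZ : Measurable Z) (y : ℝ) :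
    LineIntegrable ν (callKernel Q Z y) := by
  have := lineIntegrable_inv_fourier_denominator_mul hν
    (f := fun z => Complex.exp (-Complex.I * z * y) * genCharFun Q Z (-z))
    (C := Real.exp (ν * y) * ∫ ω, Real.exp (ν * Z ω) ∂Q) ?_ ?_
  · refine this.congr (ae_of_all _ fun x => ?_)
    exact (callKernel_eq _ _).symm
  · refine AEStronglyMeasurable.mul ?_ (stronglyMeasurable_genCharFun_line hZ).aestronglyMeasurable
    exact Continuous.aestronglyMeasurable (by fun_prop)
  · intro x
    rw [norm_mul, norm_exp_neg_I_mul_line]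
    exact mul_le_mul_of_nonneg_left (norm_genCharFun_line_le x) (Real.exp_pos _).le

/-- The payoff is inverted for each scenario. Fubini applies because the modulus of the joint
integrand is exactly a product: `exp (ν y) exp (ν Z)` times the modulus of the kernel. -/
theorem integral_max_exp_sub_one_eq [IsFiniteMeasure Q] (hν : 1 < ν) (hZ : Measurable Z)
    (hint : Integrable (fun ω => Real.exp (ν * Z ω)) Q) (y : ℝ) :
    ((∫ ω, max (Real.exp (y + Z ω) - 1) 0 ∂Q : ℝ) : ℂ) =
      1 / (2 * Real.pi) * lineIntegral ν (callKernel Q Z y) := by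
  rw [← integral_complex_ofReal]
  simp only [max_exp_sub_one_eq_lineIntegral hν, lineIntegral]
  rw [integral_const_mul]
  congr 1
  rw [integral_integral_swap]
  · refine integral_congr_ae (ae_of_all _ fun x => ?_)
    simp only
    rw [callKernel_eq, genCharFun, ← integral_const_mul, ← integral_const_mul]
    refine integral_congr_ae (ae_of_all _ fun ω => ?_)
    simp only
    rw [← Complex.exp_add, div_eq_mul_one_div, mul_comm]
    congr 2
    push_cast
    ring
  · have h1 := (hint.mul_prod (lineIntegrable_inv_fourier_denominator hν).norm).const_mul
      (Real.exp (ν * y))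
    refine h1.mono' (Measurable.aestronglyMeasurable ?_) (ae_of_all _ fun p => le_of_eq ?_)
    · unfold Function.uncurry
      fun_prop
    · simp only [Function.uncurry]
      rw [div_eq_mul_one_div, norm_mul, norm_exp_neg_I_mul_line, mul_add, Real.exp_add, mul_assoc]

end CallKernel

/-! ### The law of a random time with a hazard rate -/

section Hazard

variable {lam : ℝ → ℝ}

theorem intervalIntegral_nonneg_of_rate {a b : ℝ} (h0 : ∀ s, 0 ≤ s → 0 ≤ lam s) (ha : 0 ≤ a)
    (hab : a ≤ b) : 0 ≤ ∫ s in a..b, lam s :=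
  intervalIntegral.integral_nonneg hab fun s hs => h0 s (ha.trans hs.1)

/-- The function `x ↦ exp (-x)` is `1`-Lipschitz on `[0, ∞)`, so composing with it preserves
absolute continuity. -/
theorem absolutelyContinuousOnInterval_exp_neg {g : ℝ → ℝ} {a b : ℝ}
    (hg : AbsolutelyContinuousOnInterval g a b) (h0 : ∀ x ∈ Set.uIcc a b, 0 ≤ g x) :
    AbsolutelyContinuousOnInterval (fun x => Real.exp (-g x)) a b := by
  have hlip : ∀ p q : ℝ, 0 ≤ p → 0 ≤ q → |Real.exp (-p) - Real.exp (-q)| ≤ |p - q| := by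
    intro p q hp hq
    wlog hpq : p ≤ q generalizing p q
    · rw [abs_sub_comm, abs_sub_comm p]
      exact this q p hq hp (le_of_not_ge hpq)
    have h1 : Real.exp (-q) ≤ Real.exp (-p) := Real.exp_le_exp.2 (by linarith)
    have h2 : Real.exp (-q) = Real.exp (-p) * Real.exp (p - q) := by
      rw [← Real.exp_add]; ring_nf
    have h3 : 1 + (p - q) ≤ Real.exp (p - q) := by linarith [Real.add_one_le_exp (p - q)]
    have h4 : Real.exp (-p) ≤ 1 := Real.exp_le_one_iff.2 (by linarith)
    rw [abs_of_nonneg (by linarith), abs_of_nonpos (by linarith)]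
    nlinarith [Real.exp_pos (-p)]
  rw [absolutelyContinuousOnInterval_iff] at hg ⊢
  intro ε hε
  obtain ⟨δ, hδ, H⟩ := hg ε hε
  refine ⟨δ, hδ, fun E hE hlt => (Finset.sum_le_sum fun i hi => ?_).trans_lt (H E hE hlt)⟩
  have := hE.1 i hi
  exact hlip _ _ (h0 _ this.1) (h0 _ this.2)

/-- The rate is merely integrable, so its primitive is differentiable only almost everywhere. The
fundamental theorem of calculus is therefore used in its absolutely continuous form. -/
theorem integral_rate_mul_exp_neg (h0 : ∀ s, 0 ≤ s → 0 ≤ lam s)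
    (hi : ∀ t, 0 ≤ t → IntervalIntegrable lam volume 0 t) {a b : ℝ} (ha : 0 ≤ a) (hab : a ≤ b) :
    ∫ u in a..b, lam u * Real.exp (-∫ s in (0 : ℝ)..u, lam s) =
      Real.exp (-∫ s in (0 : ℝ)..a, lam s) - Real.exp (-∫ s in (0 : ℝ)..b, lam s) := by
  have hb : 0 ≤ b := ha.trans hab
  have hAC : AbsolutelyContinuousOnInterval (fun x => Real.exp (-∫ s in (0 : ℝ)..x, lam s)) 0 b :=
    absolutelyContinuousOnInterval_exp_neg
      ((hi b hb).absolutelyContinuousOnInterval_intervalIntegral Set.left_mem_uIcc)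
      fun x hx => by
        rw [Set.uIcc_of_le hb] at hx
        exact intervalIntegral_nonneg_of_rate h0 le_rfl hx.1
  have hsub : Set.uIcc a b ⊆ Set.uIcc 0 b := by
    rw [Set.uIcc_of_le hab, Set.uIcc_of_le hb]
    exact Set.Icc_subset_Icc_left ha
  have h1 := (hAC.mono hsub).integral_deriv_eq_sub
  have h2 : ∫ u in a..b, deriv (fun x => Real.exp (-∫ s in (0 : ℝ)..x, lam s)) u =
      ∫ u in a..b, -(lam u * Real.exp (-∫ s in (0 : ℝ)..u, lam s)) := by
    refine intervalIntegral.integral_congr_ae ?_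
    filter_upwards [(hi b hb).ae_hasDerivAt_integral] with x hx hxab
    have hx' := hx (hsub (Set.uIoc_subset_uIcc hxab)) 0 Set.left_mem_uIcc
    have hx'' : HasDerivAt (fun x => Real.exp (-∫ s in (0 : ℝ)..x, lam s)) _ x := hx'.neg.exp
    rw [hx''.deriv]
    simp only [Pi.neg_apply]
    ring
  rw [h2, intervalIntegral.integral_neg] at h1
  linarith

/-! ### The random time as a real random variable with a density -/

variable {Ω : Type*} {m : MeasurableSpace Ω} {Q : Measure Ω} {τ : Ω → WithTop ℝ≥0}

theorem measurable_of_measurableSet_le (hτ : ∀ s : ℝ≥0, MeasurableSet {ω | τ ω ≤ s}) :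
    Measurable τ := by
  refine measurable_of_Iic fun x => ?_
  induction x using WithTop.recTopCoe with
  | top => simp
  | coe s => exact hτ s

/-- The random time as a real number, with the value `T + 1` in place of `∞`. -/
noncomputable def realTime (τ : Ω → WithTop ℝ≥0) (T : ℝ≥0) (ω : Ω) : ℝ :=
  ((τ ω).untopD (T + 1) : ℝ≥0)

theorem measurable_realTime (hτ : Measurable τ) (T : ℝ≥0) : Measurable (realTime τ T) :=
  measurable_coe_nnreal_real.comp (hτ.untopD _)

theorem realTime_le_iff {s T : ℝ≥0} (hs : s ≤ T) (ω : Ω) : realTime τ T ω ≤ s ↔ τ ω ≤ s := by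
  rw [realTime, NNReal.coe_le_coe]
  rcases τ ω with _ | u
  · exact iff_of_false (not_le.2 (hs.trans_lt (lt_add_one T))) (WithTop.not_top_le_coe s)
  · exact WithTop.coe_le_coe.symm

theorem toNNReal_realTime_of_le {T : ℝ≥0} {ω : Ω} (h : τ ω ≤ T) :
    ((realTime τ T ω).toNNReal : WithTop ℝ≥0) = τ ω := by
  rw [realTime, Real.toNNReal_coe]
  lift τ ω to ℝ≥0 using ne_top_of_le_ne_top WithTop.coe_ne_top h with u
  rfl

theorem continuousOn_exp_neg_rate (hi : ∀ t, 0 ≤ t → IntervalIntegrable lam volume 0 t) {a b : ℝ}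
    (ha : 0 ≤ a) (hab : a ≤ b) :
    ContinuousOn (fun u => Real.exp (-∫ s in (0 : ℝ)..u, lam s)) (Set.uIcc a b) := by
  have hsub : Set.uIcc a b ⊆ Set.uIcc 0 b := by
    rw [Set.uIcc_of_le hab, Set.uIcc_of_le (ha.trans hab)]
    exact Set.Icc_subset_Icc_left ha
  exact ((intervalIntegral.continuousOn_primitive_interval' (hi b (ha.trans hab))
    Set.left_mem_uIcc).neg.rexp).mono hsub

theorem intervalIntegrable_rate_mul_exp_neg
    (hi : ∀ t, 0 ≤ t → IntervalIntegrable lam volume 0 t) {a b : ℝ} (ha : 0 ≤ a) (hab : a ≤ b) :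
    IntervalIntegrable (fun u => lam u * Real.exp (-∫ s in (0 : ℝ)..u, lam s)) volume a b := by
  refine IntervalIntegrable.mul_continuousOn ((hi b (ha.trans hab)).mono_set ?_)
    (continuousOn_exp_neg_rate hi ha hab)
  rw [Set.uIcc_of_le hab, Set.uIcc_of_le (ha.trans hab)]
  exact Set.Icc_subset_Icc_left ha

theorem map_realTime_Ioc [IsProbabilityMeasure Q] (hτ : Measurable τ)
    (hlam : HasHazardRate τ lam Q) {t a T : ℝ≥0} (hta : t ≤ a) (haT : a ≤ T) :
    Q.map (realTime τ T) (Set.Ioc t a) = ∫⁻ u in Set.Ioc (t : ℝ) a,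
      ENNReal.ofReal (lam u * Real.exp (-∫ s in (0 : ℝ)..u, lam s)) := by
  have hta' : (t : ℝ) ≤ a := hta
  have h1 := ofReal_integral_eq_lintegral_ofReal
    ((intervalIntegrable_iff_integrableOn_Ioc_of_le hta').1
      (intervalIntegrable_rate_mul_exp_neg hlam.integrable t.coe_nonneg hta'))
    ((ae_restrict_iff' measurableSet_Ioc).2 (ae_of_all _ fun u hu =>
      mul_nonneg (hlam.nonneg u (t.coe_nonneg.trans hu.1.le)) (Real.exp_pos _).le))
  rw [← h1, ← intervalIntegral.integral_of_le hta',
    integral_rate_mul_exp_neg hlam.nonneg hlam.integrable t.coe_nonneg hta',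
    ENNReal.ofReal_sub _ (Real.exp_pos _).le, ← hlam.survival t, ← hlam.survival a,
    Measure.map_apply (measurable_realTime hτ T) measurableSet_Ioc, ← measure_sdiff]
  · congr 1
    ext ω
    simp only [Set.mem_preimage, Set.mem_Ioc, Set.mem_sdiff, Set.mem_ofPred_eq, not_lt]
    rw [realTime_le_iff haT, ← not_le, realTime_le_iff (hta.trans haT), not_le]
  · exact fun ω hω => lt_of_le_of_lt (WithTop.coe_le_coe.2 hta) hω
  · exact (hτ measurableSet_Ioi).nullMeasurableSet
  · exact measure_ne_top _ _

/-- Two finite measures with the same distribution function agree. The restriction to `(t, T]`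
discards the artificial value `T + 1` and everything else outside the horizon. -/
theorem map_realTime_restrict [IsProbabilityMeasure Q] (hτ : Measurable τ)
    (hlam : HasHazardRate τ lam Q) (t T : ℝ≥0) :
    (Q.map (realTime τ T)).restrict (Set.Ioc t T) =
      (volume.restrict (Set.Ioc (t : ℝ) T)).withDensity
        fun u => ENNReal.ofReal (lam u * Real.exp (-∫ s in (0 : ℝ)..u, lam s)) := by
  have hP : IsProbabilityMeasure (Q.map (realTime τ T)) :=
    Measure.isProbabilityMeasure_map (measurable_realTime hτ T).aemeasurable
  refine Measure.ext_of_Iic _ _ fun a => ?_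
  rw [Measure.restrict_apply measurableSet_Iic, withDensity_apply _ measurableSet_Iic,
    Measure.restrict_restrict measurableSet_Iic, Set.inter_comm, Set.Ioc_inter_Iic]
  -- Below `t` both sides vanish; otherwise `T ⊓ a` is a nonnegative time in `[t, T]`, where the
  -- survival function is known.
  rcases lt_or_ge ((T : ℝ) ⊓ a) t with h | h
  · rw [Set.Ioc_eq_empty (not_lt.2 h.le)]
    simp
  · lift (T : ℝ) ⊓ a to ℝ≥0 using t.coe_nonneg.trans h with b hb
    exact map_realTime_Ioc hτ hlam h (by rw [← NNReal.coe_le_coe, hb]; exact inf_le_left)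

theorem setIntegral_map_realTime [IsProbabilityMeasure Q] (hτ : Measurable τ)
    (hlam : HasHazardRate τ lam Q) {t T : ℝ≥0} (htT : t ≤ T) (h : ℝ → ℝ) :
    ∫ u in Set.Ioc (t : ℝ) T, h u ∂(Q.map (realTime τ T)) =
      ∫ u in (t : ℝ)..T, lam u * Real.exp (-∫ s in (0 : ℝ)..u, lam s) * h u := by
  rw [map_realTime_restrict hτ hlam t T, integral_withDensity_eq_integral_toReal_smul₀,
    intervalIntegral.integral_of_le (NNReal.coe_le_coe.2 htT)]
  · refine setIntegral_congr_fun measurableSet_Ioc fun u hu => ?_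
    simp only [smul_eq_mul]
    rw [ENNReal.toReal_ofReal]
    exact mul_nonneg (hlam.nonneg u (t.coe_nonneg.trans hu.1.le)) (Real.exp_pos _).le
  · exact ((intervalIntegrable_iff_integrableOn_Ioc_of_le (NNReal.coe_le_coe.2 htT)).1
      (intervalIntegrable_rate_mul_exp_neg hlam.integrable t.coe_nonneg
        (NNReal.coe_le_coe.2 htT))).aemeasurable.ennreal_ofReal
  · exact ae_of_all _ fun u => ENNReal.ofReal_lt_top

end Hazard

/-! ### Exponential models with independent increments -/

variable {Ω : Type*} {m : MeasurableSpace Ω}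

/-- An exponential price model on `[0, T]` whose driver has independent right-continuous
increments, whose discounted price has constant expectation, and whose remaining increments have
`ν`-exponential moments bounded by `M`. -/
structure IsExpModel (F : Filtration ℝ≥0 m) (X : ℝ≥0 → Ω → ℝ) (r : ℝ) (S : ℝ≥0 → Ω → ℝ)
    (Q : Measure Ω) (T : ℝ≥0) (ν M : ℝ) : Prop extends IsExpPrice F X r S Q where
  adapted_driver : StronglyAdapted F X
  indep : ∀ s u, s ≤ u →
    Indep (MeasurableSpace.comap (fun ω => X u ω - X s ω) inferInstance) (F s) Q
  right_cont : ∀ᵐ ω ∂Q, ∀ s, ContinuousWithinAt (fun s => X s ω) (Set.Ici s) s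
  integrable_exp : ∀ s u, s ≤ u → u ≤ T → Integrable (fun ω => Real.exp (X u ω - X s ω)) Q
  integral_exp : ∀ s u, s ≤ u → u ≤ T → ∫ ω, Real.exp (X u ω - X s ω) ∂Q = 1
  integrable_exp_mul : ∀ u, u ≤ T → Integrable (fun ω => Real.exp (ν * (X T ω - X u ω))) Q
  integral_exp_mul_le : ∀ u, u ≤ T → ∫ ω, Real.exp (ν * (X T ω - X u ω)) ∂Q ≤ M

/-- The undiscounted value `E (exp (y + Z) - 1)⁺` of a call with log-moneyness `y`. -/
noncomputable def callValue (Q : Measure Ω) (Z : Ω → ℝ) (y : ℝ) : ℝ :=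
  ∫ ω, max (Real.exp (y + Z ω) - 1) 0 ∂Q

theorem IsExpPrice.pos_ae {F : Filtration ℝ≥0 m} {X S : ℝ≥0 → Ω → ℝ} {d : ℝ} {Q : Measure Ω}
    (h : IsExpPrice F X d S Q) : ∀ᵐ ω ∂Q, ∀ s, 0 < S s ω := by
  filter_upwards [h.pos, h.dynamics] with ω h0 h1 s
  rw [h1 0 s zero_le]
  positivity

theorem IsExpPrice.measurable {F : Filtration ℝ≥0 m} {X S : ℝ≥0 → Ω → ℝ} {d : ℝ} {Q : Measure Ω}
    (h : IsExpPrice F X d S Q) (s : ℝ≥0) : Measurable (S s) :=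
  (h.adapted s).measurable.mono (F.le s) le_rfl

theorem sub_max_eq {S y z c : ℝ} (hS : 0 ≤ S) :
    max (S * Real.exp (y + z) - S * c) 0 = S * max (Real.exp (y + z) - c) 0 := by
  rw [mul_max_of_nonneg _ _ hS, mul_zero, mul_sub]

theorem max_mul_exp_sub {a K y z : ℝ} (ha : 0 < a) (hK : 0 < K) :
    max (a * Real.exp (y + z) - K) 0 = K * max (Real.exp (Real.log (a / K) + y + z) - 1) 0 := by
  rw [mul_max_of_nonneg _ _ hK.le, mul_zero, add_assoc, Real.exp_add (Real.log (a / K)),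
    Real.exp_log (div_pos ha hK)]
  congr 1
  field_simp

namespace IsExpModel

variable {F : Filtration ℝ≥0 m} {X S : ℝ≥0 → Ω → ℝ} {Q : Measure Ω} {r ν M : ℝ} {T : ℝ≥0}

theorem measurable_driver (h : IsExpModel F X r S Q T ν M) (s : ℝ≥0) : Measurable (X s) :=
  (h.adapted_driver s).measurable.mono (F.le s) le_rfl

theorem measurable_increment (h : IsExpModel F X r S Q T ν M) (s u : ℝ≥0) :
    Measurable fun ω => X u ω - X s ω :=
  (h.measurable_driver u).sub (h.measurable_driver s)

theorem condExp_mul_increment [IsProbabilityMeasure Q] (h : IsExpModel F X r S Q T ν M)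
    {s u : ℝ≥0} (hsu : s ≤ u) {ψ : ℝ → ℝ} (hψ : Measurable ψ)
    (hint : Integrable (fun ω => S s ω * ψ (X u ω - X s ω)) Q) :
    Q[fun ω => S s ω * ψ (X u ω - X s ω) | F s] =ᵐ[Q]
      fun ω => S s ω * ∫ ω', ψ (X u ω' - X s ω') ∂Q := by
  have hg : @Measurable _ _ (@Prod.instMeasurableSpace Ω ℝ (F s) _) _
      (fun p : Ω × ℝ => S s p.1 * ψ p.2) := by
    refine Measurable.mul ?_ ?_
    · exact (h.adapted s).measurable.comp (@measurable_fst Ω ℝ (F s) _)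
    · exact hψ.comp (@measurable_snd Ω ℝ (F s) _)
  refine (condExp_of_indep (F.le s) (h.measurable_increment s u) (h.indep s u hsu).symm hg
    hint).trans (ae_of_all _ fun ω => ?_)
  simp only
  rw [integral_const_mul, integral_map (h.measurable_increment s u).aemeasurable
    hψ.aestronglyMeasurable]

theorem integrable_mul_increment (h : IsExpModel F X r S Q T ν M)
    {s u : ℝ≥0} (hsu : s ≤ u) {ψ : ℝ → ℝ} (hψ : Measurable ψ) (hS : Integrable (S s) Q)
    (hint : Integrable (fun ω => ψ (X u ω - X s ω)) Q) :
    Integrable (fun ω => S s ω * ψ (X u ω - X s ω)) Q := by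
  have h1 : IndepFun (S s) (fun ω => X u ω - X s ω) Q :=
    indep_of_indep_of_le_left (h.indep s u hsu).symm (h.adapted s).measurable.comap_le
  exact (h1.comp measurable_id hψ).integrable_mul hS hint

theorem price_eq (h : IsExpModel F X r S Q T ν M) : ∀ᵐ ω ∂Q, ∀ s u, s ≤ u →
    S u ω = S s ω * (Real.exp (r * ((u : ℝ) - s)) * Real.exp (X u ω - X s ω)) := by
  filter_upwards [h.dynamics] with ω hω s u hsu
  rw [hω s u hsu, Real.exp_add]

theorem integrable_price (h : IsExpModel F X r S Q T ν M) {u : ℝ≥0}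
    (huT : u ≤ T) : Integrable (S u) Q := by
  have h1 := h.integrable_mul_increment (zero_le : 0 ≤ u)
    (ψ := fun z => Real.exp (r * ((u : ℝ) - (0 : ℝ≥0))) * Real.exp z) (by fun_prop) h.integrable
    ((h.integrable_exp 0 u zero_le huT).const_mul _)
  refine h1.congr ?_
  filter_upwards [h.price_eq] with ω hω
  exact (hω 0 u zero_le).symm

/-- The martingale property of the discounted price, recovered from independence and the unit mean
of `exp (X u - X s)`. -/
theorem condExp_price [IsProbabilityMeasure Q] (h : IsExpModel F X r S Q T ν M) {s u : ℝ≥0}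
    (hsu : s ≤ u) (huT : u ≤ T) :
    Q[S u | F s] =ᵐ[Q] fun ω => S s ω * Real.exp (r * ((u : ℝ) - s)) := by
  have h0 : S u =ᵐ[Q] fun ω => S s ω * (Real.exp (r * ((u : ℝ) - s)) * Real.exp (X u ω - X s ω)) := by
    filter_upwards [h.price_eq] with ω hω
    exact hω s u hsu
  refine (condExp_congr_ae h0).trans ((h.condExp_mul_increment hsu
    (ψ := fun z => Real.exp (r * ((u : ℝ) - s)) * Real.exp z) (by fun_prop)
    ((h.integrable_price huT).congr h0)).trans (ae_of_all _ fun ω => ?_))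
  simp only
  rw [integral_const_mul, h.integral_exp s u hsu huT, mul_one]

theorem integrable_call (h : IsExpModel F X r S Q T ν M) {u : ℝ≥0} (huT : u ≤ T) (y : ℝ) :
    Integrable (fun ω => max (Real.exp (y + (X T ω - X u ω)) - 1) 0) Q := by
  have hm := h.measurable_increment u T
  refine ((h.integrable_exp u T huT le_rfl).const_mul (Real.exp y)).mono'
    (Measurable.aestronglyMeasurable (by fun_prop)) (ae_of_all _ fun ω => ?_)
  rw [Real.norm_of_nonneg (le_max_right _ _), ← Real.exp_add]
  exact max_le (by linarith) (Real.exp_pos _).le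

/-- The payoff is homogeneous in `S u`, so conditioning on `ℱ_u` leaves `S u` times a constant. The
tower property then gives `S t exp (r (u - t))`, and the growth factor shortens the discounting
period to `[u, T]`. -/
theorem forwardStartPrice_ae_eq [IsProbabilityMeasure Q] (h : IsExpModel F X r S Q T ν M)
    {t u : ℝ≥0} (htu : t ≤ u) (huT : u ≤ T) {α : ℝ} (hα : 0 < α) :
    forwardStartPrice Q F r S α t u T =ᵐ[Q] fun ω => S t ω * (Real.exp (-r * ((T : ℝ) - u)) * α *
      callValue Q (fun ω => X T ω - X u ω) (-Real.log α + r * ((T : ℝ) - u))) := by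
  set ψ : ℝ → ℝ := fun z => Real.exp (-r * ((T : ℝ) - t)) * (α *
    max (Real.exp ((-Real.log α + r * ((T : ℝ) - u)) + z) - 1) 0) with hψ
  have hψm : Measurable ψ := by fun_prop
  have h0 : (fun ω => Real.exp (-r * ((T : ℝ) - t)) * max (S T ω - α * S u ω) 0) =ᵐ[Q]
      fun ω => S u ω * ψ (X T ω - X u ω) := by
    filter_upwards [h.price_eq, h.pos_ae] with ω hω hpos
    have h1 := sub_max_eq (y := r * ((T : ℝ) - u)) (z := X T ω - X u ω) (c := α) (hpos u).le
    rw [Real.exp_add] at h1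
    have h2 := max_mul_exp_sub (a := 1) (y := r * ((T : ℝ) - u)) (z := X T ω - X u ω) one_pos hα
    rw [one_mul, Real.exp_add] at h2
    rw [hω u T huT, hψ, mul_comm α, h1, h2]
    simp only [one_div, Real.log_inv]
    ring
  have hint : Integrable (fun ω => S u ω * ψ (X T ω - X u ω)) Q :=
    h.integrable_mul_increment huT hψm (h.integrable_price huT)
      (((h.integrable_call huT _).const_mul _).const_mul _)
  have h1 := h.condExp_mul_increment huT hψm hint
  have h2 : Q[fun ω => S u ω * ψ (X T ω - X u ω) | F t] =ᵐ[Q]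
      fun ω => (∫ ω', ψ (X T ω' - X u ω') ∂Q) * (S t ω * Real.exp (r * ((u : ℝ) - t))) := by
    refine (condExp_condExp_of_le (F.mono htu) (F.le u)).symm.trans
      ((condExp_congr_ae h1).trans ?_)
    have h3 : (fun ω => S u ω * ∫ ω', ψ (X T ω' - X u ω') ∂Q) =
        (∫ ω', ψ (X T ω' - X u ω') ∂Q) • S u := by
      ext ω
      simp [mul_comm]
    rw [h3]
    refine (condExp_smul _ _ _).trans ?_
    filter_upwards [h.condExp_price htu huT] with ω hω
    rw [Pi.smul_apply, hω, smul_eq_mul]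
  refine ((condExp_congr_ae h0).trans h2).trans (ae_of_all _ fun ω => ?_)
  simp only [hψ]
  rw [integral_const_mul, integral_const_mul, callValue]
  have h4 : Real.exp (-r * ((T : ℝ) - u)) =
      Real.exp (-r * ((T : ℝ) - t)) * Real.exp (r * ((u : ℝ) - t)) := by
    rw [← Real.exp_add]
    ring_nf
  rw [h4]
  ring

/-- With a fixed strike the payoff is no longer `S u` times a function of the increment, so freezing
is needed for a general function of the pair. -/
theorem callPrice_ae_eq [IsProbabilityMeasure Q] (h : IsExpModel F X r S Q T ν M)
    {u : ℝ≥0} (huT : u ≤ T) {K : ℝ} (hK : 0 < K) :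
    callPrice Q F r S K u T =ᵐ[Q] fun ω => Real.exp (-r * ((T : ℝ) - u)) * K *
      callValue Q (fun ω => X T ω - X u ω) (Real.log (S u ω / K) + r * ((T : ℝ) - u)) := by
  set g : Ω × ℝ → ℝ := fun p => Real.exp (-r * ((T : ℝ) - u)) *
    max (S u p.1 * Real.exp (r * ((T : ℝ) - u) + p.2) - K) 0 with hg
  have hgm : @Measurable _ _ (@Prod.instMeasurableSpace Ω ℝ (F u) _) _ g := by
    have h1 := (h.adapted u).measurable.comp (@measurable_fst Ω ℝ (F u) Real.measurableSpace)
    have h2 := @measurable_snd Ω ℝ (F u) Real.measurableSpace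
    exact (((h1.mul (h2.const_add _).exp).sub_const _).max measurable_const).const_mul _
  have h0 : (fun ω => Real.exp (-r * ((T : ℝ) - u)) * max (S T ω - K) 0) =ᵐ[Q]
      fun ω => g (ω, X T ω - X u ω) := by
    filter_upwards [h.dynamics] with ω hω
    rw [hω u T huT]
  have hint : Integrable (fun ω => g (ω, X T ω - X u ω)) Q := by
    refine Integrable.congr ?_ h0
    refine Integrable.const_mul ?_ _
    have := (h.integrable_price (le_refl T))
    exact (this.sub (integrable_const K)).sup (integrable_zero _ _ _)
  refine (condExp_congr_ae h0).trans ((condExp_of_indep (F.le u) (h.measurable_increment u T)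
    (h.indep u T huT).symm hgm hint).trans ?_)
  filter_upwards [h.pos_ae] with ω hpos
  rw [integral_map (h.measurable_increment u T).aemeasurable
    (Measurable.aestronglyMeasurable (by simp only [hg]; fun_prop))]
  simp only [hg]
  rw [integral_const_mul, callValue, mul_assoc]
  congr 1
  rw [← integral_const_mul]
  refine integral_congr_ae (ae_of_all _ fun ω' => ?_)
  exact max_mul_exp_sub (hpos u) hK

end IsExpModel

/-! ### Conditioning on the enlarged filtration -/

section Enlarged

variable {Ω : Type*} {m : MeasurableSpace Ω} {F : Filtration ℝ≥0 m} {τ : Ω → WithTop ℝ≥0}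
  {hτ : ∀ s : ℝ≥0, MeasurableSet[m] {ω | τ ω ≤ (s : WithTop ℝ≥0)}} {Q : Measure Ω}

/-- The sets `A` with this property form a σ-algebra. It contains `ℱ_t`, and it contains each
generator `{τ ≤ s}` with `s ≤ t`, for which `B = ∅` works since the generator misses `{t < τ}`. -/
theorem exists_measurableSet_inter_eq {t : ℝ≥0} {A : Set Ω}
    (hA : MeasurableSet[enlarged F τ hτ t] A) :
    ∃ B, MeasurableSet[F t] B ∧ A ∩ {ω | t < τ ω} = B ∩ {ω | t < τ ω} := by
  let G : MeasurableSpace Ω :=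
    { MeasurableSet' := fun A => ∃ B, MeasurableSet[F t] B ∧ A ∩ {ω | t < τ ω} = B ∩ {ω | t < τ ω}
      measurableSet_empty := ⟨∅, @MeasurableSet.empty Ω (F t), rfl⟩
      measurableSet_compl := by
        rintro A ⟨B, hB, h⟩
        refine ⟨Bᶜ, hB.compl, ?_⟩
        ext ω
        have := Set.ext_iff.1 h ω
        simp only [Set.mem_inter_iff, Set.mem_compl_iff] at this ⊢
        tauto
      measurableSet_iUnion := by
        intro f hf
        choose B hB h using hf
        refine ⟨⋃ i, B i, MeasurableSet.iUnion hB, ?_⟩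
        rw [Set.iUnion_inter, Set.iUnion_inter]
        exact Set.iUnion_congr h }
  have hle : F t ⊔ jumpFiltration τ hτ t ≤ G := by
    refine sup_le (fun B hB => ⟨B, hB, rfl⟩) (MeasurableSpace.generateFrom_le ?_)
    rintro _ ⟨s, hs, rfl⟩
    refine ⟨∅, @MeasurableSet.empty Ω (F t), ?_⟩
    rw [Set.empty_inter]
    refine Set.eq_empty_of_forall_notMem fun ω hω => ?_
    exact absurd (hω.1.trans (WithTop.coe_le_coe.2 hs)) (not_le.2 hω.2)
  exact hle A hA

theorem measurableSet_lt_enlarged (t : ℝ≥0) :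
    MeasurableSet[enlarged F τ hτ t] {ω | t < τ ω} := by
  have h := isStoppingTime_enlarged F τ hτ t
  have h2 := h.compl
  convert h2 using 1
  ext ω
  exact (@not_le (WithTop ℝ≥0) _ _ _).symm

theorem indep_realTime (hIND : IND F τ hτ Q) (T : ℝ≥0) :
    Indep (⨆ t, F t) (MeasurableSpace.comap (realTime τ T) inferInstance) Q := by
  refine indep_of_indep_of_le_right hIND ?_
  have h : @Measurable Ω (WithTop ℝ≥0) (⨆ t, jumpFiltration τ hτ t) _ τ := by
    refine @measurable_of_measurableSet_le Ω (⨆ t, jumpFiltration τ hτ t) τ fun s => ?_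
    exact le_iSup (fun t => (jumpFiltration τ hτ t : MeasurableSpace Ω)) s _
      (MeasurableSpace.measurableSet_generateFrom ⟨s, le_rfl, rfl⟩)
  exact (@measurable_realTime Ω (⨆ t, jumpFiltration τ hτ t) τ h T).comap_le

theorem realTime_mem_Ioc_iff {t T : ℝ≥0} (htT : t ≤ T) (ω : Ω) :
    realTime τ T ω ∈ Set.Ioc (t : ℝ) T ↔ t < τ ω ∧ τ ω ≤ T := by
  rw [Set.mem_Ioc, realTime_le_iff le_rfl, ← not_le, realTime_le_iff htT, not_le]

/-- Stated over an unspecified σ-algebra so that it can be applied with `⨆ t, F t`, the one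
independent of the random time. -/
theorem stronglyMeasurable_indicator_payoff {S : Ω → ℝ} (hS : Measurable S)
    {V : ℝ≥0 × Ω → ℝ} (hV : Measurable V) {B : Set Ω} (hB : MeasurableSet B) (a b c : ℝ) :
    StronglyMeasurable fun p : Ω × ℝ => (B ×ˢ Set.Ioc a b).indicator (fun p : Ω × ℝ =>
      c * max (S p.1 - V (p.2.toNNReal, p.1)) 0) p := by
  refine (Measurable.indicator ?_ (hB.prod measurableSet_Ioc)).stronglyMeasurable
  fun_prop

theorem stoppedProcess_of_le {S : ℝ≥0 → Ω → ℝ} {T : ℝ≥0} {ω : Ω} (h : τ ω ≤ T) :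
    stoppedProcess S τ T ω = S (realTime τ T ω).toNNReal ω := by
  rw [stoppedProcess, min_eq_right h, ← toNNReal_realTime_of_le h]
  rfl

theorem stoppedProcess_of_ge {S : ℝ≥0 → Ω → ℝ} {T : ℝ≥0} {ω : Ω} (h : T ≤ τ ω) :
    stoppedProcess S τ T ω = S T ω := by
  rw [stoppedProcess, min_eq_left h]
  rfl

end Enlarged

/-! ### The random time forward-start price as a time integral -/

/-- The price at time `u`, per unit of the asset, of the at-the-money call issued at `u`. -/
noncomputable def atmPrice {Ω : Type*} {m : MeasurableSpace Ω} (Q : Measure Ω)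
    (X : ℝ≥0 → Ω → ℝ) (r : ℝ) (T : ℝ≥0) (u : ℝ) : ℝ :=
  Real.exp (-r * ((T : ℝ) - u)) *
    callValue Q (fun ω => X T ω - X u.toNNReal ω) (r * ((T : ℝ) - u))

namespace IsExpModel

variable {Ω : Type*} {m : MeasurableSpace Ω} {F : Filtration ℝ≥0 m} {X S : ℝ≥0 → Ω → ℝ}
  {Q : Measure Ω} {r ν M : ℝ} {t T : ℝ≥0} {τ : Ω → WithTop ℝ≥0} {lam : ℝ → ℝ}
  {hτ : ∀ s : ℝ≥0, MeasurableSet[m] {ω | τ ω ≤ (s : WithTop ℝ≥0)}}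

theorem rightVersion_price_eq (h : IsExpModel F X r S Q T ν M) :
    ∀ᵐ ω ∂Q, ∀ s, rightVersion S (s, ω) = S s ω := by
  filter_upwards [h.right_cont, h.dynamics] with ω hω hd s
  refine rightVersion_eq ?_
  have h1 : (fun s => S s ω) =
      fun s : ℝ≥0 => S 0 ω * Real.exp (r * ((s : ℝ) - (0 : ℝ≥0)) + (X s ω - X 0 ω)) :=
    funext fun s => hd 0 s zero_le
  rw [h1]
  have h2 := hω s
  have h3 : ContinuousWithinAt (fun s : ℝ≥0 => (s : ℝ)) (Set.Ici s) s :=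
    NNReal.continuous_coe.continuousWithinAt
  exact (((h3.sub continuousWithinAt_const).const_mul r).add (h2.sub continuousWithinAt_const)).rexp.const_mul _

/-- Evaluation at a random time needs joint measurability, which the right-continuous version
provides; it agrees with `S` at all times simultaneously, almost surely. -/
theorem aestronglyMeasurable_price_at (h : IsExpModel F X r S Q T ν M) {σ : Ω → ℝ≥0}
    (hσ : Measurable σ) : AEStronglyMeasurable (fun ω => S (σ ω) ω) Q := by
  have h1 : Measurable fun ω => rightVersion S (σ ω, ω) :=
    (measurable_rightVersion h.measurable).comp (hσ.prodMk measurable_id)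
  refine h1.aestronglyMeasurable.congr ?_
  filter_upwards [h.rightVersion_price_eq] with ω hω
  exact hω _

theorem integrable_max_sub (h : IsExpModel F X r S Q T ν M) {σ : Ω → ℝ≥0}
    (hσ : Measurable σ) : Integrable (fun ω => max (S T ω - S (σ ω) ω) 0) Q := by
  refine (h.integrable_price (le_refl T)).mono' ?_ ?_
  · exact (((h.measurable T).aestronglyMeasurable).sub (h.aestronglyMeasurable_price_at hσ)).sup
      aestronglyMeasurable_const
  · filter_upwards [h.pos_ae] with ω hω
    rw [Real.norm_of_nonneg (le_max_right _ _)]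
    exact max_le (by linarith [hω (σ ω)]) (hω T).le

theorem integrable_fixedPayoff (h : IsExpModel F X r S Q T ν M) (hτm : Measurable τ) :
    Integrable (fixedPayoff r S τ t T) Q :=
  -- Where `τ = ∞`, the stopped value is read at a default time. The bound by `S T` holds at every
  -- time, so the choice is harmless.
  (h.integrable_max_sub hτm.untopA).const_mul _

theorem integrable_rtfsPayoff (h : IsExpModel F X r S Q T ν M) (hτm : Measurable τ) :
    Integrable (rtfsPayoff r S τ 1 t T) Q := by
  unfold rtfsPayoff
  simp only [one_mul]
  exact (h.integrable_max_sub (measurable_const.min hτm).untopA).const_mul _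

theorem setIntegral_forwardStart [IsProbabilityMeasure Q] (h : IsExpModel F X r S Q T ν M)
    {u : ℝ≥0} (htu : t ≤ u) (huT : u ≤ T) {B : Set Ω} (hB : MeasurableSet[F t] B) :
    ∫ ω in B, Real.exp (-r * ((T : ℝ) - t)) * max (S T ω - S u ω) 0 ∂Q =
      (∫ ω in B, S t ω ∂Q) * atmPrice Q X r T u := by
  have h1 := h.forwardStartPrice_ae_eq htu huT one_pos
  simp only [forwardStartPrice, one_mul, Real.log_one, neg_zero, zero_add, mul_one] at h1
  rw [← setIntegral_condExp (F.le t)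
    ((h.integrable_max_sub (σ := fun _ => u) measurable_const).const_mul _) hB,
    setIntegral_congr_ae (F.le t B hB) (h1.mono fun ω hω _ => hω), integral_mul_const, atmPrice,
    Real.toNNReal_coe]

/-- The random time is independent of the whole market, so it can be frozen at `u`: the inner
expectation is that of a forward-start call determined at `u`, and the outer integral runs over the
density of `τ` on `(t, T]`. -/
theorem setIntegral_rtfsPayoff [IsProbabilityMeasure Q] (h : IsExpModel F X r S Q T ν M)
    (htT : t ≤ T) (hτm : Measurable τ) (hIND : IND F τ hτ Q) (hlam : HasHazardRate τ lam Q)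
    {B : Set Ω} (hB : MeasurableSet[F t] B) :
    ∫ ω in B ∩ {ω | t < τ ω}, rtfsPayoff r S τ 1 t T ω ∂Q =
      (∫ ω in B, S t ω ∂Q) *
        ∫ u in (t : ℝ)..T, lam u * Real.exp (-∫ s in (0 : ℝ)..u, lam s) * atmPrice Q X r T u := by
  have hle : (⨆ t, F t : MeasurableSpace Ω) ≤ m := iSup_le F.le
  have hBF : MeasurableSet[⨆ t, F t] B := le_iSup (fun t => (F t : MeasurableSpace Ω)) t B hB
  have hSF : ∀ s, Measurable[⨆ t, F t] (S s) := fun s =>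
    (h.adapted s).measurable.mono (le_iSup (fun t => (F t : MeasurableSpace Ω)) s) le_rfl
  set f : Ω × ℝ → ℝ := fun p => (B ×ˢ Set.Ioc (t : ℝ) T).indicator (fun p =>
    Real.exp (-r * ((T : ℝ) - t)) * max (S T p.1 - rightVersion S (p.2.toNNReal, p.1)) 0) p with hf
  have hfm : @StronglyMeasurable _ _ _ (@Prod.instMeasurableSpace Ω ℝ (⨆ t, F t) _) f := by
    exact @stronglyMeasurable_indicator_payoff Ω (⨆ t, F t) (S T) (hSF T) _
      (@measurable_rightVersion Ω (⨆ t, F t) S hSF) B hBF t T _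
  have heq : (B ∩ {ω | t < τ ω}).indicator (rtfsPayoff r S τ 1 t T) =ᵐ[Q]
      fun ω => f (ω, realTime τ T ω) := by
    filter_upwards [h.rightVersion_price_eq] with ω hω
    have hR := realTime_mem_Ioc_iff (τ := τ) htT ω
    simp only [hf]
    by_cases hmem : ω ∈ B ∧ t < τ ω
    · rw [Set.indicator_of_mem (show ω ∈ B ∩ {ω | t < τ ω} from hmem)]
      rcases le_or_gt (τ ω) T with hle | hlt
      · rw [Set.indicator_of_mem (Set.mk_mem_prod hmem.1 (hR.2 ⟨hmem.2, hle⟩)), rtfsPayoff,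
          stoppedProcess_of_le hle, one_mul, hω]
      -- For `τ > T` the strike is `S T` and the payoff is zero, so cutting off at `T` loses
      -- nothing.
      · rw [Set.indicator_of_notMem fun hp => not_le.2 hlt (hR.1 hp.2).2, rtfsPayoff,
          stoppedProcess_of_ge hlt.le]
        simp
    · rw [Set.indicator_of_notMem (show ω ∉ B ∩ {ω | t < τ ω} from hmem),
        Set.indicator_of_notMem fun hp => hmem ⟨hp.1, (hR.1 hp.2).1⟩]
  have hint : Integrable (fun ω => f (ω, realTime τ T ω)) Q :=
    ((h.integrable_rtfsPayoff hτm).indicator ((F.le t B hB).inter (hτm measurableSet_Ioi))).congr heq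
  have hmeas : MeasurableSet (B ∩ {ω | t < τ ω}) := (F.le t B hB).inter (hτm measurableSet_Ioi)
  rw [← integral_indicator hmeas, integral_congr_ae heq]
  refine (integral_of_indep (g := f) hle (measurable_realTime hτm T) (indep_realTime hIND T)
    hfm hint).trans ?_
  rw [← intervalIntegral.integral_const_mul]
  have hinner : (fun e => ∫ ω, f (ω, e) ∂Q) = (Set.Ioc (t : ℝ) T).indicator fun e =>
      (∫ ω in B, S t ω ∂Q) * atmPrice Q X r T e := by
    ext e
    simp only [hf]
    by_cases he : e ∈ Set.Ioc (t : ℝ) T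
    · rw [Set.indicator_of_mem he]
      lift e to ℝ≥0 using t.coe_nonneg.trans he.1.le
      rw [← h.setIntegral_forwardStart (NNReal.coe_le_coe.1 he.1.le) (NNReal.coe_le_coe.1 he.2) hB,
        ← integral_indicator (F.le t B hB)]
      refine integral_congr_ae ?_
      filter_upwards [h.rightVersion_price_eq] with ω hω
      by_cases hB : ω ∈ B
      · rw [Set.indicator_of_mem (Set.mk_mem_prod hB he), Set.indicator_of_mem hB, hω,
          Real.toNNReal_coe]
      · rw [Set.indicator_of_notMem fun hp => hB hp.1, Set.indicator_of_notMem hB]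
    · rw [Set.indicator_of_notMem he, ← integral_zero Ω ℝ (μ := Q)]
      exact integral_congr_ae (ae_of_all _ fun ω => Set.indicator_of_notMem (fun hp => he hp.2) _)
  rw [hinner, integral_indicator measurableSet_Ioc, setIntegral_map_realTime hτm hlam htT]
  refine intervalIntegral.integral_congr fun u _ => ?_
  ring

theorem setIntegral_price_inter [IsProbabilityMeasure Q] (h : IsExpModel F X r S Q T ν M)
    (htT : t ≤ T) (hτm : Measurable τ) (hIND : IND F τ hτ Q) (hlam : HasHazardRate τ lam Q)
    {B : Set Ω} (hB : MeasurableSet[F t] B) :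
    ∫ ω in B ∩ {ω | t < τ ω}, S t ω ∂Q =
      (∫ ω in B, S t ω ∂Q) * Real.exp (-∫ s in (0 : ℝ)..t, lam s) := by
  have hBF : MeasurableSet[⨆ t, F t] B := le_iSup (fun t => (F t : MeasurableSpace Ω)) t B hB
  have hSF : Measurable[⨆ t, F t] (S t) :=
    (h.adapted t).measurable.mono (le_iSup (fun t => (F t : MeasurableSpace Ω)) t) le_rfl
  have hD : MeasurableSet {ω | t < τ ω} := hτm measurableSet_Ioi
  have hind : IndepFun (B.indicator (S t)) (realTime τ T) Q :=
    indep_of_indep_of_le_left (indep_realTime hIND T) (hSF.indicator hBF).comap_le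
  have hind' := hind.comp measurable_id
    (measurable_const.indicator measurableSet_Ioi : Measurable ((Set.Ioi (t : ℝ)).indicator
      fun _ => (1 : ℝ)))
  have heq : {ω | t < τ ω} = realTime τ T ⁻¹' Set.Ioi (t : ℝ) := by
    ext ω
    rw [Set.mem_preimage, Set.mem_Ioi, ← not_le, realTime_le_iff htT, not_le]
    rfl
  have hone : (Set.Ioi (t : ℝ)).indicator (fun _ => (1 : ℝ)) ∘ realTime τ T =
      {ω | t < τ ω}.indicator fun _ => (1 : ℝ) := by
    rw [heq]
    rfl
  have hmul := hind'.integral_mul_eq_mul_integral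
    ((hSF.mono (iSup_le F.le) le_rfl).indicator (F.le t B hB)).aestronglyMeasurable
    (by rw [hone]; exact (measurable_const.indicator hD).aestronglyMeasurable)
  rw [hone, integral_indicator hD, setIntegral_const, smul_eq_mul, mul_one, measureReal_def,
    hlam.survival t, ENNReal.toReal_ofReal (Real.exp_pos _).le, Function.id_comp,
    integral_indicator (F.le t B hB)] at hmul
  rw [← hmul, ← integral_indicator ((F.le t B hB).inter hD)]
  refine integral_congr_ae (ae_of_all _ fun ω => ?_)
  classical
  by_cases h1 : ω ∈ B <;> simp [Set.indicator_apply, h1]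

/-- Both sides are compared on `B ∩ {t < τ}` with `B ∈ ℱ_t`. The right side picks up the survival
probability at `t`, the left side the density of `τ`; their ratio is the conditional density of `τ`
given survival up to `t`. -/
theorem condExp_rtfsPayoff_indicator [IsProbabilityMeasure Q] (h : IsExpModel F X r S Q T ν M)
    (htT : t ≤ T) (hIND : IND F τ hτ Q) (hlam : HasHazardRate τ lam Q) :
    Q[{ω | t < τ ω}.indicator (rtfsPayoff r S τ 1 t T) | enlarged F τ hτ t] =ᵐ[Q]
      {ω | t < τ ω}.indicator fun ω => S t ω *
        ∫ u in (t : ℝ)..T, lam u * Real.exp (-∫ s in (t : ℝ)..u, lam s) * atmPrice Q X r T u := by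
  have hτm := measurable_of_measurableSet_le hτ
  have hD : MeasurableSet {ω | t < τ ω} := hτm measurableSet_Ioi
  have hSt := h.integrable_price htT
  set C := ∫ u in (t : ℝ)..T, lam u * Real.exp (-∫ s in (t : ℝ)..u, lam s) * atmPrice Q X r T u
    with hC
  have hC' : ∫ u in (t : ℝ)..T, lam u * Real.exp (-∫ s in (0 : ℝ)..u, lam s) *
      atmPrice Q X r T u = Real.exp (-∫ s in (0 : ℝ)..t, lam s) * C := by
    rw [hC, ← intervalIntegral.integral_const_mul]
    refine intervalIntegral.integral_congr fun u hu => ?_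
    rw [Set.uIcc_of_le (NNReal.coe_le_coe.2 htT)] at hu
    have hu0 : 0 ≤ u := t.coe_nonneg.trans hu.1
    have h1 : (∫ s in (0 : ℝ)..t, lam s) + ∫ s in (t : ℝ)..u, lam s = ∫ s in (0 : ℝ)..u, lam s :=
      intervalIntegral.integral_add_adjacent_intervals (hlam.integrable t t.coe_nonneg)
        ((hlam.integrable t t.coe_nonneg).symm.trans (hlam.integrable u hu0))
    rw [← h1, neg_add, Real.exp_add]
    ring
  refine (ae_eq_condExp_of_forall_setIntegral_eq ((enlarged F τ hτ).le t)
    ((h.integrable_rtfsPayoff hτm).indicator hD)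
    (fun A _ _ => ((hSt.mul_const C).indicator hD).integrableOn) ?_ ?_).symm
  · intro A hA _
    obtain ⟨B, hB, hAB⟩ := exists_measurableSet_inter_eq hA
    rw [setIntegral_indicator hD, setIntegral_indicator hD, hAB, integral_mul_const,
      h.setIntegral_price_inter htT hτm hIND hlam hB, h.setIntegral_rtfsPayoff htT hτm hIND hlam hB,
      hC', mul_assoc]
  · have hF : F t ≤ enlarged F τ hτ t := le_sup_left
    exact (((h.adapted t).mono hF).mul_const C |>.indicator
      (measurableSet_lt_enlarged t)).aestronglyMeasurable

theorem rtfsPrice_ae_eq [IsProbabilityMeasure Q] (h : IsExpModel F X r S Q T ν M)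
    (htT : t ≤ T) (hIND : IND F τ hτ Q) (hlam : HasHazardRate τ lam Q) :
    rtfsPrice Q (enlarged F τ hτ) r S τ 1 t T =ᵐ[Q] fun ω =>
      fixedStrikePart Q (enlarged F τ hτ) r S τ t T ω +
      {ω | t < τ ω}.indicator (fun ω => S t ω *
        ∫ u in (t : ℝ)..T, lam u * Real.exp (-∫ s in (t : ℝ)..u, lam s) * atmPrice Q X r T u) ω := by
  have hτm := measurable_of_measurableSet_le hτ
  have hD : MeasurableSet {ω | t < τ ω} := hτm measurableSet_Ioi
  have hD' : MeasurableSet[enlarged F τ hτ t] {ω | τ ω ≤ t} := isStoppingTime_enlarged F τ hτ t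
  have hsplit : rtfsPayoff r S τ 1 t T = {ω | τ ω ≤ t}.indicator (fixedPayoff r S τ t T) +
      {ω | t < τ ω}.indicator (rtfsPayoff r S τ 1 t T) := by
    ext ω
    rcases le_or_gt (τ ω) t with hω | hω
    · rw [Pi.add_apply, Set.indicator_of_mem (show ω ∈ {ω | τ ω ≤ t} from hω),
        Set.indicator_of_notMem (show ω ∉ {ω | t < τ ω} from not_lt.2 hω), add_zero, rtfsPayoff,
        fixedPayoff, one_mul, stoppedProcess,
        min_eq_right (hω.trans (WithTop.coe_le_coe.2 htT)), stoppedValue]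
    · rw [Pi.add_apply, Set.indicator_of_notMem (show ω ∉ {ω | τ ω ≤ t} from not_le.2 hω),
        Set.indicator_of_mem (show ω ∈ {ω | t < τ ω} from hω), zero_add]
  -- Survival at time `0` has probability `exp 0 = 1`; hence `{τ ≤ t}` may be replaced by `{0 < τ ≤
  -- t}`.
  have hzero : ∀ᵐ ω ∂Q, 0 < τ ω := by
    have h0 := hlam.survival 0
    simp only [NNReal.coe_zero, intervalIntegral.integral_same, neg_zero, Real.exp_zero,
      ENNReal.ofReal_one, WithTop.coe_zero] at h0
    exact (mem_ae_iff_prob_eq_one (hτm measurableSet_Ioi)).2 h0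
  have h1 : rtfsPrice Q (enlarged F τ hτ) r S τ 1 t T =ᵐ[Q]
      Q[{ω | τ ω ≤ t}.indicator (fixedPayoff r S τ t T) | enlarged F τ hτ t] +
      Q[{ω | t < τ ω}.indicator (rtfsPayoff r S τ 1 t T) | enlarged F τ hτ t] := by
    rw [rtfsPrice]
    refine (condExp_congr_ae (Eventually.of_forall fun ω => congrFun hsplit ω)).trans ?_
    exact condExp_add ((h.integrable_fixedPayoff hτm).indicator ((enlarged F τ hτ).le t _ hD'))
      ((h.integrable_rtfsPayoff hτm).indicator hD) _
  filter_upwards [h1, h.condExp_rtfsPayoff_indicator htT hIND hlam,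
    condExp_indicator (h.integrable_fixedPayoff (t := t) (T := T) hτm) hD', hzero] with ω e1 e2 e3 e4
  rw [e1, Pi.add_apply, e2, e3, fixedStrikePart]
  congr 1
  classical
  simp [Set.indicator_apply, e4]

end IsExpModel

/-! ### Contour integral representation of the time integral -/

namespace IsExpModel

variable {Ω : Type*} {m : MeasurableSpace Ω} {F : Filtration ℝ≥0 m} {X S : ℝ≥0 → Ω → ℝ}
  {Q : Measure Ω} {r ν M : ℝ} {t T : ℝ≥0} {τ : Ω → WithTop ℝ≥0} {lam : ℝ → ℝ}
  {hτ : ∀ s : ℝ≥0, MeasurableSet[m] {ω | τ ω ≤ (s : WithTop ℝ≥0)}}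

theorem ofReal_callValue_eq [IsProbabilityMeasure Q] (h : IsExpModel F X r S Q T ν M) (hν : 1 < ν)
    {u : ℝ≥0} (huT : u ≤ T) (y : ℝ) : (callValue Q (fun ω => X T ω - X u ω) y : ℂ) =
      1 / (2 * Real.pi) * lineIntegral ν (callKernel Q (fun ω => X T ω - X u ω) y) :=
  integral_max_exp_sub_one_eq hν (h.measurable_increment u T) (h.integrable_exp_mul u huT) y

/-- Joint measurability in time and contour variable, required for Fubini. The driver is replaced by
its right-continuous version, which leaves every expectation unchanged. -/
theorem stronglyMeasurable_genCharFun [IsProbabilityMeasure Q] (h : IsExpModel F X r S Q T ν M) :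
    StronglyMeasurable fun p : ℝ × ℝ =>
      genCharFun Q (fun ω => X T ω - X p.1.toNNReal ω) (-((p.2 : ℂ) + ν * Complex.I)) := by
  have hV := measurable_rightVersion h.measurable_driver
  have hX := h.measurable_driver T
  have h1 : StronglyMeasurable fun p : ℝ × ℝ => ∫ ω, Complex.exp (Complex.I *
      -((p.2 : ℂ) + ν * Complex.I) * ((X T ω - rightVersion X (p.1.toNNReal, ω) : ℝ) : ℂ)) ∂Q := by
    refine StronglyMeasurable.integral_prod_right (f := fun (p : ℝ × ℝ) ω => Complex.exp (Complex.I *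
      -((p.2 : ℂ) + ν * Complex.I) * ((X T ω - rightVersion X (p.1.toNNReal, ω) : ℝ) : ℂ))) ?_
    refine Measurable.stronglyMeasurable ?_
    unfold Function.uncurry
    fun_prop
  convert h1 using 1
  ext p
  refine integral_congr_ae ?_
  filter_upwards [h.right_cont] with ω hω
  rw [rightVersion_eq (hω _)]

/-- The bound is independent of `x` and integrable in `u`; multiplied by the kernel it dominates the
double integral. This is where a moment bound `M` uniform in time is needed. -/
theorem norm_timeIntegrand_le (h : IsExpModel F X r S Q T ν M) (hν : 1 < ν)
    (hlam : ∀ s, 0 ≤ s → 0 ≤ lam s) (x : ℝ) {u : ℝ} (hu : u ∈ Set.Ioc (t : ℝ) T) :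
    ‖timeIntegrand Q X r lam t T ((x : ℂ) + ν * Complex.I) u‖ ≤
      Real.exp (|r| * T * (ν - 1)) * M * lam u := by
  have hu0 : 0 ≤ u := t.coe_nonneg.trans hu.1.le
  have h1 : ‖Complex.exp (-(r : ℂ) * ((T : ℂ) - (u : ℂ)) *
      (1 + Complex.I * ((x : ℂ) + ν * Complex.I)))‖ ≤ Real.exp (|r| * T * (ν - 1)) := by
    rw [Complex.norm_exp, Real.exp_le_exp]
    have h2 : (-(r : ℂ) * ((T : ℂ) - (u : ℂ)) * (1 + Complex.I * ((x : ℂ) + ν * Complex.I))).re =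
        r * (T - u) * (ν - 1) := by
      simp
      ring
    rw [h2]
    refine mul_le_mul_of_nonneg_right ?_ (by linarith)
    exact mul_le_mul (le_abs_self r) (by linarith) (by linarith [hu.2]) (abs_nonneg r)
  have h3 : ‖genCharFun Q (fun ω => X T ω - X u.toNNReal ω) (-((x : ℂ) + ν * Complex.I))‖ ≤ M :=
    (norm_genCharFun_line_le x).trans
      (h.integral_exp_mul_le _ (Real.toNNReal_le_iff_le_coe.2 hu.2))
  have h4 : ‖((lam u * Real.exp (-∫ s in (t : ℝ)..u, lam s) : ℝ) : ℂ)‖ ≤ lam u := by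
    have := hlam u hu0
    rw [Complex.norm_real, Real.norm_of_nonneg (by positivity)]
    refine mul_le_of_le_one_right this (Real.exp_le_one_iff.2 ?_)
    linarith [intervalIntegral_nonneg_of_rate hlam t.coe_nonneg hu.1.le]
  rw [timeIntegrand, norm_mul, norm_mul]
  exact mul_le_mul (mul_le_mul h1 h3 (norm_nonneg _) (Real.exp_pos _).le) h4 (norm_nonneg _)
    (mul_nonneg (Real.exp_pos _).le ((norm_nonneg _).trans h3))

theorem aestronglyMeasurable_rate (hlam : HasHazardRate τ lam Q) (htT : t ≤ T) :
    AEStronglyMeasurable (fun u => ((lam u * Real.exp (-∫ s in (t : ℝ)..u, lam s) : ℝ) : ℂ))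
      (volume.restrict (Set.Ioc (t : ℝ) T)) := by
  have hsub : IntervalIntegrable lam volume t T :=
    (hlam.integrable t t.coe_nonneg).symm.trans (hlam.integrable T T.coe_nonneg)
  have htT' : (t : ℝ) ≤ T := htT
  refine Complex.continuous_ofReal.comp_aestronglyMeasurable (AEStronglyMeasurable.mul
    (((intervalIntegrable_iff_integrableOn_Ioc_of_le htT').1 hsub).aestronglyMeasurable) ?_)
  refine ContinuousOn.aestronglyMeasurable ?_ measurableSet_Ioc
  refine ((intervalIntegral.continuousOn_primitive_interval' hsub Set.left_mem_uIcc).neg.rexp).mono ?_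
  rw [Set.uIcc_of_le htT']
  exact Set.Ioc_subset_Icc_self

theorem intervalIntegrable_timeIntegrand [IsProbabilityMeasure Q] (h : IsExpModel F X r S Q T ν M)
    (hν : 1 < ν) (hlam : HasHazardRate τ lam Q) (htT : t ≤ T) (x : ℝ) :
    IntervalIntegrable (timeIntegrand Q X r lam t T ((x : ℂ) + ν * Complex.I)) volume t T := by
  have htT' : (t : ℝ) ≤ T := htT
  have hint : IntegrableOn lam (Set.Ioc (t : ℝ) T) :=
    (intervalIntegrable_iff_integrableOn_Ioc_of_le htT').1
      ((hlam.integrable t t.coe_nonneg).symm.trans (hlam.integrable T T.coe_nonneg))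
  rw [intervalIntegrable_iff_integrableOn_Ioc_of_le htT']
  refine (hint.const_mul (Real.exp (|r| * T * (ν - 1)) * M)).mono' ?_
    ((ae_restrict_iff' measurableSet_Ioc).2 (ae_of_all _ fun u hu =>
      h.norm_timeIntegrand_le hν hlam.nonneg x hu))
  refine AEStronglyMeasurable.mul (AEStronglyMeasurable.mul ?_ ?_)
    (aestronglyMeasurable_rate hlam htT)
  · exact Continuous.aestronglyMeasurable (by fun_prop)
  · exact (h.stronglyMeasurable_genCharFun.comp_measurable
      (measurable_prodMk_right (y := x))).aestronglyMeasurable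

theorem integrable_prod_timeIntegrand [IsProbabilityMeasure Q] (h : IsExpModel F X r S Q T ν M)
    (hν : 1 < ν) (hlam : HasHazardRate τ lam Q) (htT : t ≤ T) :
    Integrable (fun p : ℝ × ℝ => 1 / (Complex.I * ((p.2 : ℂ) + ν * Complex.I) -
      ((p.2 : ℂ) + ν * Complex.I) ^ 2) *
        timeIntegrand Q X r lam t T ((p.2 : ℂ) + ν * Complex.I) p.1)
      ((volume.restrict (Set.Ioc (t : ℝ) T)).prod volume) := by
  have htT' : (t : ℝ) ≤ T := htT
  have hint : IntegrableOn lam (Set.Ioc (t : ℝ) T) :=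
    (intervalIntegrable_iff_integrableOn_Ioc_of_le htT').1
      ((hlam.integrable t t.coe_nonneg).symm.trans (hlam.integrable T T.coe_nonneg))
  refine ((hint.const_mul (Real.exp (|r| * T * (ν - 1)) * M)).mul_prod
    (lineIntegrable_inv_fourier_denominator hν).norm).mono' ?_ ?_
  · refine AEStronglyMeasurable.mul ?_ (AEStronglyMeasurable.mul (AEStronglyMeasurable.mul ?_
      h.stronglyMeasurable_genCharFun.aestronglyMeasurable)
      (aestronglyMeasurable_rate hlam htT).comp_fst)
    · exact ((continuous_inv_fourier_denominator hν).comp continuous_snd).aestronglyMeasurable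
    · exact Continuous.aestronglyMeasurable (by fun_prop)
  · have h1 : ∀ᵐ p ∂((volume.restrict (Set.Ioc (t : ℝ) T)).prod (volume : Measure ℝ)),
        p.1 ∈ Set.Ioc (t : ℝ) T :=
      Measure.quasiMeasurePreserving_fst.ae (ae_restrict_mem measurableSet_Ioc)
    filter_upwards [h1] with p hp
    rw [norm_mul, mul_comm]
    exact mul_le_mul_of_nonneg_right (h.norm_timeIntegrand_le hν hlam.nonneg p.2 hp) (norm_nonneg _)

theorem lineIntegrable_timeIntegral [IsProbabilityMeasure Q] (h : IsExpModel F X r S Q T ν M)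
    (hν : 1 < ν) (hlam : HasHazardRate τ lam Q) (htT : t ≤ T) :
    LineIntegrable ν (fun z => 1 / (Complex.I * z - z ^ 2) *
      ∫ u in (t : ℝ)..T, timeIntegrand Q X r lam t T z u) := by
  have h1 := (h.integrable_prod_timeIntegrand hν hlam htT).integral_prod_right
  refine h1.congr (ae_of_all _ fun x => ?_)
  simp only
  rw [integral_const_mul, intervalIntegral.integral_of_le (NNReal.coe_le_coe.2 htT)]

/-- The factor `exp (-r (T - u) (1 + i z))` is the discount factor times the Fourier factor of the
log-moneyness `r (T - u)`. -/
theorem mul_atmPrice_eq [IsProbabilityMeasure Q] (h : IsExpModel F X r S Q T ν M)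
    (hν : 1 < ν) {u : ℝ} (hu : u ∈ Set.Ioc (t : ℝ) T) :
    ((lam u * Real.exp (-∫ s in (t : ℝ)..u, lam s) * atmPrice Q X r T u : ℝ) : ℂ) =
      1 / (2 * Real.pi) * lineIntegral ν fun z => 1 / (Complex.I * z - z ^ 2) *
        timeIntegrand Q X r lam t T z u := by
  rw [atmPrice, Complex.ofReal_mul, Complex.ofReal_mul (Real.exp (-r * ((T : ℝ) - u))),
    h.ofReal_callValue_eq hν (Real.toNNReal_le_iff_le_coe.2 hu.2), mul_left_comm (_ : ℂ) (1 / _),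
    mul_left_comm (_ : ℂ) (1 / _), lineIntegral, lineIntegral, ← integral_const_mul,
    ← integral_const_mul]
  congr 1
  refine integral_congr_ae (ae_of_all _ fun x => ?_)
  simp only
  set z := (x : ℂ) + ν * Complex.I
  have h1 : Complex.exp (-(r : ℂ) * ((T : ℂ) - (u : ℂ)) * (1 + Complex.I * z)) =
      ((Real.exp (-r * ((T : ℝ) - u)) : ℝ) : ℂ) *
        Complex.exp (-Complex.I * z * ((r * ((T : ℝ) - u) : ℝ) : ℂ)) := by
    rw [Complex.ofReal_exp, ← Complex.exp_add]
    congr 1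
    push_cast
    ring
  rw [callKernel_eq, timeIntegrand, h1]
  ring

theorem ofReal_integral_atmPrice_eq [IsProbabilityMeasure Q] (h : IsExpModel F X r S Q T ν M)
    (hν : 1 < ν) (hlam : HasHazardRate τ lam Q) (htT : t ≤ T) :
    ((∫ u in (t : ℝ)..T, lam u * Real.exp (-∫ s in (t : ℝ)..u, lam s) * atmPrice Q X r T u : ℝ) : ℂ) =
      1 / (2 * Real.pi) * lineIntegral ν fun z => 1 / (Complex.I * z - z ^ 2) *
        ∫ u in (t : ℝ)..T, timeIntegrand Q X r lam t T z u := by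
  have htT' : (t : ℝ) ≤ T := htT
  rw [intervalIntegral.integral_of_le htT', ← integral_complex_ofReal,
    setIntegral_congr_fun measurableSet_Ioc fun u hu => h.mul_atmPrice_eq hν hu,
    integral_const_mul]
  congr 1
  simp only [lineIntegral]
  rw [integral_integral_swap (h.integrable_prod_timeIntegrand hν hlam htT)]
  refine integral_congr_ae (ae_of_all _ fun x => ?_)
  simp only
  rw [integral_const_mul, intervalIntegral.integral_of_le htT']

theorem rtfsPrice_ae_eq_lineIntegral [IsProbabilityMeasure Q] (h : IsExpModel F X r S Q T ν M)
    (hν : 1 < ν) (htT : t ≤ T) (hIND : IND F τ hτ Q) (hlam : HasHazardRate τ lam Q) :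
    ∀ᵐ ω ∂Q, (rtfsPrice Q (enlarged F τ hτ) r S τ 1 t T ω : ℂ) =
      (fixedStrikePart Q (enlarged F τ hτ) r S τ t T ω : ℂ) +
        {ω | (t : WithTop ℝ≥0) < τ ω}.indicator (fun ω => ((S t ω / (2 * Real.pi) : ℝ) : ℂ) *
          lineIntegral ν (fun z => 1 / (Complex.I * z - z ^ 2) *
            ∫ u in (t : ℝ)..T, timeIntegrand Q X r lam t T z u)) ω := by
  filter_upwards [h.rtfsPrice_ae_eq htT hIND hlam] with ω hω
  rw [hω, Complex.ofReal_add]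
  congr 1
  by_cases hmem : ω ∈ {ω | (t : WithTop ℝ≥0) < τ ω}
  · rw [Set.indicator_of_mem hmem, Set.indicator_of_mem hmem, Complex.ofReal_mul,
      h.ofReal_integral_atmPrice_eq hν hlam htT]
    push_cast
    ring
  · rw [Set.indicator_of_notMem hmem, Set.indicator_of_notMem hmem, Complex.ofReal_zero]

end IsExpModel

/-! ### Exponential Lévy models -/

section Levy

variable {Ω : Type*} {m : MeasurableSpace Ω} {F : Filtration ℝ≥0 m} {X S : ℝ≥0 → Ω → ℝ}
  {Q : Measure Ω} {r ν : ℝ} {T : ℝ≥0}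

/-- The discounted price at `u` is the one at `s` times the independent factor `exp (X u - X s)`.
Integrability of a product of independent factors passes to one factor when the other is not almost
surely zero, and equal positive expectations cancel. -/
theorem integrable_exp_increment_of_martingale [IsProbabilityMeasure Q] (hX : IsLevyProcess F X Q)
    (hS : IsExpPrice F X r S Q)
    (hM : Martingale (fun (s : ℝ≥0) ω => Real.exp (-r * (s : ℝ)) * S s ω) F Q) {s u : ℝ≥0}
    (hsu : s ≤ u) : Integrable (fun ω => Real.exp (X u ω - X s ω)) Q ∧
      ∫ ω, Real.exp (X u ω - X s ω) ∂Q = 1 := by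
  have hXm : ∀ s, Measurable (X s) := fun s => (hX.adapted s).measurable.mono (F.le s) le_rfl
  have hZ : Measurable fun ω => X u ω - X s ω := (hXm u).sub (hXm s)
  have h0 : IndepFun (S s) (fun ω => X u ω - X s ω) Q :=
    indep_of_indep_of_le_left (hX.indep s u hsu).symm (hS.adapted s).measurable.comap_le
  have hind : IndepFun (fun ω => Real.exp (-r * (s : ℝ)) * S s ω)
      (fun ω => Real.exp (X u ω - X s ω)) Q :=
    h0.comp (measurable_id.const_mul (Real.exp (-r * (s : ℝ)))) Real.measurable_exp
  have heq : (fun ω => Real.exp (-r * (u : ℝ)) * S u ω) =ᵐ[Q]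
      fun ω => (Real.exp (-r * (s : ℝ)) * S s ω) * Real.exp (X u ω - X s ω) := by
    filter_upwards [hS.dynamics] with ω hω
    rw [hω s u hsu, Real.exp_add, mul_left_comm, ← mul_assoc (Real.exp _) (Real.exp _),
      ← Real.exp_add, mul_assoc, mul_left_comm]
    ring_nf
  have hpos : 0 < ∫ ω, Real.exp (-r * (s : ℝ)) * S s ω ∂Q := by
    refine (integral_pos_iff_support_of_nonneg_ae ?_ (hM.integrable s)).2 ?_
    · filter_upwards [hS.pos_ae] with ω hω
      have := hω s
      positivity
    · have : Function.support (fun ω => Real.exp (-r * (s : ℝ)) * S s ω) =ᵐ[Q] Set.univ := by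
        filter_upwards [hS.pos_ae] with ω hω
        have := hω s
        refine eq_true ?_
        exact (by positivity : Real.exp (-r * (s : ℝ)) * S s ω ≠ 0)
      rw [measure_congr this]
      simp
  have hne : ¬ (fun ω => Real.exp (-r * (s : ℝ)) * S s ω) =ᵐ[Q] 0 := fun h => by
    rw [integral_congr_ae h] at hpos
    simp at hpos
  have hint : Integrable (fun ω => Real.exp (X u ω - X s ω)) Q :=
    hind.integrable_right_of_integrable_op (· * ·) 1 one_ne_zero (by simp [enorm_mul]) ((hM.integrable u).congr heq)
      (hM.integrable s).aestronglyMeasurable hZ.exp.aestronglyMeasurable hne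
  refine ⟨hint, ?_⟩
  have h1 : ∫ ω, Real.exp (-r * (u : ℝ)) * S u ω ∂Q = ∫ ω, Real.exp (-r * (s : ℝ)) * S s ω ∂Q := by
    rw [← integral_condExp (F.le s), integral_congr_ae (hM.condExp_ae_eq hsu)]
  rw [integral_congr_ae heq, hind.integral_fun_mul_eq_mul_integral
    (hM.integrable s).aestronglyMeasurable hZ.exp.aestronglyMeasurable] at h1
  exact mul_left_cancel₀ hpos.ne' (h1.trans (mul_one _).symm)

theorem one_add_mul_le_exp_mul (hν : 1 ≤ ν) (x : ℝ) :
    1 + ν * (Real.exp x - 1) ≤ Real.exp (ν * x) := by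
  have h := one_add_mul_self_le_rpow_one_add
    (show (-1 : ℝ) ≤ Real.exp x - 1 by linarith [Real.exp_pos x]) hν
  rwa [add_sub_cancel, ← Real.exp_mul, mul_comm x] at h

/-- Independence factors `E exp (ν X_T)` as `E exp (ν X_u) E exp (ν (X_T - X_u))`. The first factor
is at least one, so the moment at `T` bounds those of all remaining increments. -/
theorem isExpModel_of_isLevyProcess [IsProbabilityMeasure Q] (hν : 1 < ν)
    (hX : IsLevyProcess F X Q) (hS : IsExpPrice F X r S Q)
    (hM : Martingale (fun (s : ℝ≥0) ω => Real.exp (-r * (s : ℝ)) * S s ω) F Q)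
    (hint : Integrable (fun ω => Real.exp (ν * X T ω)) Q) :
    IsExpModel F X r S Q T ν (∫ ω, Real.exp (ν * X T ω) ∂Q) := by
  have hXm : ∀ s, Measurable (X s) := fun s => (hX.adapted s).measurable.mono (F.le s) le_rfl
  have hfac : ∀ u ≤ T, Integrable (fun ω => Real.exp (ν * (X T ω - X u ω))) Q ∧
      ∫ ω, Real.exp (ν * (X T ω - X u ω)) ∂Q ≤ ∫ ω, Real.exp (ν * X T ω) ∂Q := by
    intro u hu
    have h0 : IndepFun (X u) (fun ω => X T ω - X u ω) Q :=
      indep_of_indep_of_le_left (hX.indep u T hu).symm (hX.adapted u).measurable.comap_le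
    have hind : IndepFun (fun ω => Real.exp (ν * X u ω))
        (fun ω => Real.exp (ν * (X T ω - X u ω))) Q :=
      h0.comp (measurable_id.const_mul ν).exp (measurable_id.const_mul ν).exp
    have heq : (fun ω => Real.exp (ν * X T ω)) =
        fun ω => Real.exp (ν * X u ω) * Real.exp (ν * (X T ω - X u ω)) := by
      ext ω
      rw [← Real.exp_add]
      ring_nf
    have hm1 : AEStronglyMeasurable (fun ω => Real.exp (ν * X u ω)) Q :=
      ((hXm u).const_mul ν).exp.aestronglyMeasurable
    have hm2 : AEStronglyMeasurable (fun ω => Real.exp (ν * (X T ω - X u ω))) Q :=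
      (((hXm T).sub (hXm u)).const_mul ν).exp.aestronglyMeasurable
    have hne : ∀ Z : Ω → ℝ, ¬ (fun ω => Real.exp (Z ω)) =ᵐ[Q] 0 := fun Z h => by
      obtain ⟨ω, hω⟩ := h.exists
      exact (Real.exp_pos _).ne' hω
    rw [heq] at hint ⊢
    have hi2 := hind.integrable_right_of_integrable_op (· * ·) 1 one_ne_zero (by simp [enorm_mul])
      hint hm1 hm2 (hne _)
    have hi1 := hind.integrable_left_of_integrable_op (· * ·) 1 one_ne_zero (by simp [enorm_mul])
      hint hm1 hm2 (hne _)
    refine ⟨hi2, ?_⟩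
    rw [hind.integral_fun_mul_eq_mul_integral hm1 hm2]
    refine le_mul_of_one_le_left (integral_nonneg fun ω => (Real.exp_pos _).le) ?_
    obtain ⟨he, he1⟩ := integrable_exp_increment_of_martingale hX hS hM (zero_le : 0 ≤ u)
    have hsub : Integrable (fun ω => ν * (Real.exp (X u ω - X 0 ω) - 1)) Q :=
      (he.sub (integrable_const 1)).const_mul ν
    -- Bernoulli's inequality bounds `exp (ν X_u)` below by this function, whose mean is one by the
    -- martingale property.
    have h1 : ∫ ω, (1 + ν * (Real.exp (X u ω - X 0 ω) - 1)) ∂Q = 1 := by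
      rw [integral_add (integrable_const _) hsub,
        integral_const_mul, integral_sub he (integrable_const _), he1]
      simp
    rw [← h1]
    refine integral_mono_ae ((integrable_const _).add hsub) hi1 ?_
    filter_upwards [hX.zero] with ω hω
    simp only [hω, sub_zero]
    exact one_add_mul_le_exp_mul hν.le _
  exact
    { toIsExpPrice := hS
      adapted_driver := hX.adapted
      indep := hX.indep
      right_cont := hX.cadlag.mono fun ω hω s => (hω s).1
      integrable_exp := fun s u hsu _ => (integrable_exp_increment_of_martingale hX hS hM hsu).1
      integral_exp := fun s u hsu _ => (integrable_exp_increment_of_martingale hX hS hM hsu).2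
      integrable_exp_mul := fun u hu => (hfac u hu).1
      integral_exp_mul_le := fun u hu => (hfac u hu).2 }

end Levy

/-! ### The Gaussian and Gamma laws -/

theorem lintegral_exp_mul_gaussianReal (v : ℝ≥0) (θ : ℝ) :
    ∫⁻ x, ENNReal.ofReal (Real.exp (θ * x)) ∂(gaussianReal 0 v) =
      ENNReal.ofReal (Real.exp (v * θ ^ 2 / 2)) := by
  rw [← ofReal_integral_eq_lintegral_ofReal (integrable_exp_mul_gaussianReal θ)
    (ae_of_all _ fun x => (Real.exp_pos _).le)]
  have h := congrFun (mgf_id_gaussianReal (μ := 0) (v := v)) θ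
  simp only [mgf, id, zero_mul, zero_add] at h
  rw [h]

/-- Exponential tilting keeps the Gamma shape and lowers the rate to `ρ - κ`; the normalising factor
is the moment generating function. -/
theorem gammaPDF_mul_exp {a ρ κ : ℝ} (hρ : 0 < ρ) (hκ : κ < ρ) (x : ℝ) :
    gammaPDF a ρ x * ENNReal.ofReal (Real.exp (κ * x)) =
      ENNReal.ofReal (Real.exp (-a * Real.log (1 - κ / ρ))) * gammaPDF a (ρ - κ) x := by
  rcases lt_or_ge x 0 with hx | hx
  · rw [gammaPDF_of_neg hx, gammaPDF_of_neg hx, zero_mul, mul_zero]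
  rw [gammaPDF_of_nonneg hx, gammaPDF_of_nonneg hx, ← ENNReal.ofReal_mul' (Real.exp_pos _).le,
    ← ENNReal.ofReal_mul (Real.exp_pos _).le]
  have h0 : 0 < ρ - κ := sub_pos.2 hκ
  have h1 : Real.exp (-a * Real.log (1 - κ / ρ)) * (ρ - κ) ^ a = ρ ^ a := by
    have h2 : 1 - κ / ρ = (ρ - κ) / ρ := by field_simp
    rw [h2, Real.log_div h0.ne' hρ.ne', Real.rpow_def_of_pos h0, Real.rpow_def_of_pos hρ,
      ← Real.exp_add]
    ring_nf
  have h3 : Real.exp (-((ρ - κ) * x)) = Real.exp (-(ρ * x)) * Real.exp (κ * x) := by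
    rw [← Real.exp_add]
    ring_nf
  rw [h3, ← h1]
  congr 1
  ring

theorem measurable_gammaPDF (a ρ : ℝ) : Measurable (gammaPDF a ρ) :=
  (measurable_gammaPDFReal a ρ).ennreal_ofReal

theorem lintegral_exp_mul_gammaMeasure {a ρ κ : ℝ} (ha : 0 < a) (hρ : 0 < ρ) (hκ : κ < ρ) :
    ∫⁻ x, ENNReal.ofReal (Real.exp (κ * x)) ∂(gammaMeasure a ρ) =
      ENNReal.ofReal (Real.exp (-a * Real.log (1 - κ / ρ))) := by
  rw [gammaMeasure, lintegral_withDensity_eq_lintegral_mul _ (measurable_gammaPDF a ρ) (by fun_prop)]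
  simp only [Pi.mul_apply, gammaPDF_mul_exp hρ hκ]
  rw [lintegral_const_mul _ (measurable_gammaPDF a (ρ - κ)),
    lintegral_gammaPDF_eq_one ha (sub_pos.2 hκ), mul_one]

theorem ae_nonneg_gammaMeasure (a ρ : ℝ) : ∀ᵐ x ∂(gammaMeasure a ρ), 0 ≤ x := by
  rw [gammaMeasure, ae_withDensity_iff (measurable_gammaPDF a ρ)]
  refine ae_of_all _ fun x hx => ?_
  by_contra h
  exact hx (gammaPDF_of_neg (not_le.1 h))

/-! ### Exponential moments of Variance Gamma increments -/

section VarianceGamma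

variable {Ω : Type*} {m : MeasurableSpace Ω} {Q : Measure Ω} {μ : ℝ}

theorem IsGammaProcess.ae_le {Y : ℝ≥0 → Ω → ℝ≥0} (hY : IsGammaProcess μ Y Q) {s u : ℝ≥0}
    (hsu : s ≤ u) : ∀ᵐ ω ∂Q, Y s ω ≤ Y u ω := by
  rcases hsu.eq_or_lt with rfl | hlt
  · exact ae_of_all _ fun ω => le_rfl
  have hlaw := hY.law s u hlt
  have h1 := ae_nonneg_gammaMeasure (((u : ℝ) - s) / μ) (1 / μ)
  rw [← hlaw.map_eq] at h1
  filter_upwards [ae_of_ae_map hlaw.aemeasurable h1] with ω hω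
  exact NNReal.coe_le_coe.1 (sub_nonneg.1 hω)

theorem IsGammaProcess.lintegral_exp_mul {Y : ℝ≥0 → Ω → ℝ≥0} [IsProbabilityMeasure Q]
    (hY : IsGammaProcess μ Y Q) (hμ : 0 < μ)
    {s u : ℝ≥0} (hsu : s ≤ u) {κ : ℝ} (hκ : 0 < 1 - μ * κ) :
    ∫⁻ ω, ENNReal.ofReal (Real.exp (κ * ((Y u ω : ℝ) - Y s ω))) ∂Q =
      ENNReal.ofReal (Real.exp (-(((u : ℝ) - s) / μ) * Real.log (1 - μ * κ))) := by
  rcases hsu.eq_or_lt with rfl | hlt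
  · simp
  have hlaw := hY.law s u hlt
  have h1 : ∫⁻ ω, ENNReal.ofReal (Real.exp (κ * ((Y u ω : ℝ) - Y s ω))) ∂Q =
      ∫⁻ x, ENNReal.ofReal (Real.exp (κ * x)) ∂(gammaMeasure (((u : ℝ) - s) / μ) (1 / μ)) := by
    rw [← hlaw.map_eq, lintegral_map' (by fun_prop) hlaw.aemeasurable]
  rw [h1, lintegral_exp_mul_gammaMeasure (div_pos (sub_pos.2 (NNReal.coe_lt_coe.2 hlt)) hμ)
    (by positivity)]
  · rw [div_div_eq_mul_div, div_one, mul_comm κ]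
  · rw [lt_div_iff₀ hμ]
    linarith

theorem lintegral_exp_brownian_increment {W : ℝ≥0 → Ω → ℝ} [IsProbabilityMeasure Q]
    (hW : IsPreBrownianReal W Q) (θ : ℝ) {x y : ℝ≥0} (hxy : x ≤ y) :
    ∫⁻ ω, ENNReal.ofReal (Real.exp (θ * (W y ω - W x ω))) ∂Q =
      ENNReal.ofReal (Real.exp (θ ^ 2 / 2 * ((y : ℝ) - x))) := by
  have hlaw := hW.hasLaw_sub y x
  have h1 : ∫⁻ ω, ENNReal.ofReal (Real.exp (θ * (W y ω - W x ω))) ∂Q =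
      ∫⁻ z, ENNReal.ofReal (Real.exp (θ * z)) ∂(gaussianReal 0 (nndist y.1 x.1)) := by
    rw [← hlaw.map_eq, lintegral_map' (by fun_prop) hlaw.aemeasurable]
    rfl
  have h2 : ((nndist y.1 x.1 : ℝ≥0) : ℝ) = (y : ℝ) - x := by
    rw [coe_nndist, Real.dist_eq]
    exact abs_of_nonneg (sub_nonneg.2 hxy)
  rw [h1, lintegral_exp_mul_gaussianReal, h2]
  ring_nf

/-- Increments of the Brownian motion time-changed by a Gamma process. -/
theorem lintegral_exp_subordinated [IsProbabilityMeasure Q] {Y : ℝ≥0 → Ω → ℝ≥0}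
    {W : ℝ≥0 → Ω → ℝ} (hY : IsGammaProcess μ Y Q) (hWm : ∀ s, Measurable (W s))
    (hW : IsBrownianReal W Q) (hind : IndepFun (fun ω s => W s ω) (fun ω s => Y s ω) Q)
    (hμ : 0 < μ) {s u : ℝ≥0} (hsu : s ≤ u) (β γ : ℝ) (hκ : 0 < 1 - μ * (β + γ ^ 2 / 2)) :
    ∫⁻ ω, ENNReal.ofReal (Real.exp (β * ((Y u ω : ℝ) - Y s ω) +
        γ * (W (Y u ω) ω - W (Y s ω) ω))) ∂Q =
      ENNReal.ofReal (Real.exp (-(((u : ℝ) - s) / μ) * Real.log (1 - μ * (β + γ ^ 2 / 2)))) := by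
  -- Evaluating a path at a random clock needs a jointly measurable evaluation map on path space.
  -- `V` is one, and it is the true evaluation on continuous paths.
  set V : ℝ≥0 × (ℝ≥0 → ℝ) → ℝ := rightVersion fun s p => p s with hV
  have hVm : Measurable V := measurable_rightVersion fun s => measurable_pi_apply s
  have hcont := hW.cont
  have hWp : Measurable fun ω => fun s => W s ω := measurable_pi_lambda _ hWm
  have hYp : Measurable fun ω => (Y s ω, Y u ω) := (hY.measurable s).prodMk (hY.measurable u)
  have hind' : IndepFun (fun ω s => W s ω) (fun ω => (Y s ω, Y u ω)) Q :=
    hind.comp measurable_id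
      ((measurable_pi_apply s).prodMk (measurable_pi_apply u) :
        Measurable fun p : ℝ≥0 → ℝ≥0 => (p s, p u))
  have hVeq : ∀ᵐ ω ∂Q, ∀ y, V (y, fun s => W s ω) = W y ω := by
    filter_upwards [hcont] with ω hω y
    exact rightVersion_eq (Z := fun (s : ℝ≥0) (p : ℝ≥0 → ℝ) => p s) (ω := fun s => W s ω)
      (hω.continuousWithinAt)
  set g : (ℝ≥0 → ℝ) × (ℝ≥0 × ℝ≥0) → ℝ≥0∞ := fun p => ENNReal.ofReal (Real.exp
    (β * ((p.2.2 : ℝ) - p.2.1) + γ * (V (p.2.2, p.1) - V (p.2.1, p.1)))) with hg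
  have hgm : Measurable g := by fun_prop
  have h1 : ∫⁻ ω, ENNReal.ofReal (Real.exp (β * ((Y u ω : ℝ) - Y s ω) +
        γ * (W (Y u ω) ω - W (Y s ω) ω))) ∂Q = ∫⁻ ω, g (fun s => W s ω, (Y s ω, Y u ω)) ∂Q := by
    refine lintegral_congr_ae ?_
    filter_upwards [hVeq] with ω hω
    simp only [hg, hω]
  rw [h1, hind'.lintegral_comp_prodMk hWp hYp hgm,
    lintegral_map (Measurable.lintegral_prod_left'
      (f := fun p : Ω × (ℝ≥0 × ℝ≥0) => g (fun s => W s p.1, p.2))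
      (hgm.comp ((hWp.comp measurable_fst).prodMk measurable_snd))) hYp,
    ← hY.lintegral_exp_mul hμ hsu hκ]
  refine lintegral_congr_ae ?_
  filter_upwards [hY.ae_le hsu] with ω' hω'
  -- With the clock frozen, the Gaussian increment adds `γ² / 2` to the linear rate `β`; the Gamma
  -- moment is then taken at `β + γ² / 2`.
  have h2 : ∀ x y : ℝ≥0, x ≤ y → ∫⁻ ω, g (fun s => W s ω, (x, y)) ∂Q =
      ENNReal.ofReal (Real.exp ((β + γ ^ 2 / 2) * ((y : ℝ) - x))) := by
    intro x y hxy
    have h3 : ∫⁻ ω, g (fun s => W s ω, (x, y)) ∂Q =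
        ∫⁻ ω, ENNReal.ofReal (Real.exp (β * ((y : ℝ) - x))) *
          ENNReal.ofReal (Real.exp (γ * (W y ω - W x ω))) ∂Q := by
      refine lintegral_congr_ae ?_
      filter_upwards [hVeq] with ω hω
      simp only [hg, hω]
      rw [Real.exp_add, ENNReal.ofReal_mul (Real.exp_pos _).le]
    rw [h3, lintegral_const_mul _ (by fun_prop),
      lintegral_exp_brownian_increment hW.toIsPreBrownianReal γ hxy,
      ← ENNReal.ofReal_mul (Real.exp_pos _).le, ← Real.exp_add]
    ring_nf
  exact h2 _ _ hω'

end VarianceGamma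

/-! ### The Variance Gamma exponent -/

/-- The argument `1 - b μ ρ - c² μ ρ² / 2` of the logarithm in the Variance Gamma exponent. -/
noncomputable def vgBase (b c μ ρ : ℝ) : ℝ := 1 - b * μ * ρ - c ^ 2 * μ * ρ ^ 2 / 2

section Base

variable {b c μ ν ρ : ℝ}

theorem continuous_vgBase (b c μ : ℝ) : Continuous (vgBase b c μ) := by
  unfold vgBase
  fun_prop

theorem vgBase_zero (b c μ : ℝ) : vgBase b c μ 0 = 1 := by simp [vgBase]

theorem concaveOn_vgBase (hμ : 0 ≤ μ) (b c : ℝ) : ConcaveOn ℝ Set.univ (vgBase b c μ) := by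
  refine ⟨convex_univ, fun x _ y _ p q hp hq hpq => ?_⟩
  have h : 0 ≤ c ^ 2 * μ * (p * q * (x - y) ^ 2) := by positivity
  have hq' : q = 1 - p := by linarith
  subst hq'
  simp only [smul_eq_mul, vgBase]
  linarith [show c ^ 2 * μ * (p * (1 - p) * (x - y) ^ 2) = c ^ 2 * μ * (p * x ^ 2 + (1 - p) * y ^ 2
    - (p * x + (1 - p) * y) ^ 2) by ring]

theorem convex_vgBase_pos (hμ : 0 ≤ μ) (b c : ℝ) : Convex ℝ {ρ | 0 < vgBase b c μ ρ} := by
  simpa using (concaveOn_vgBase hμ b c).convex_gt 0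

/-- Concavity spreads positivity from the endpoints `0` and `ν`. At `ρ = 1` it makes the martingale
correction well defined. -/
theorem vgBase_pos_of_le (hμ : 0 ≤ μ) (hν : 0 < vgBase b c μ ν) (h0 : 0 ≤ ρ) (hρ : ρ ≤ ν) :
    0 < vgBase b c μ ρ := by
  have h1 : (0 : ℝ) ∈ {ρ | 0 < vgBase b c μ ρ} := by simp [vgBase_zero]
  exact (convex_vgBase_pos hμ b c).ordConnected.out h1 hν ⟨h0, hρ⟩

theorem vgOmega_eq (b c μ : ℝ) : vgOmega b c μ = 1 / μ * Real.log (vgBase b c μ 1) := by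
  rw [vgOmega, vgBase]
  ring_nf

/-- `1 - b μ w - c² μ w² / 2` for complex `w`. -/
noncomputable def vgComplexBase (b c μ : ℝ) (w : ℂ) : ℂ :=
  1 - b * μ * w - (c : ℂ) ^ 2 * μ * w ^ 2 / 2

theorem vgComplexBase_ofReal (b c μ ρ : ℝ) : vgComplexBase b c μ ρ = (vgBase b c μ ρ : ℝ) := by
  simp [vgComplexBase, vgBase]

/-- The imaginary part of `w` only adds `c² μ (Im w)² / 2` to the real part. On the strip the base
thus stays in the right half-plane, away from the cut of the principal logarithm. -/
theorem vgBase_re_le (hμ : 0 ≤ μ) (b c : ℝ) (w : ℂ) :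
    vgBase b c μ w.re ≤ (vgComplexBase b c μ w).re := by
  have h : (vgComplexBase b c μ w).re = vgBase b c μ w.re + c ^ 2 * μ * w.im ^ 2 / 2 := by
    have h1 : vgComplexBase b c μ w =
        1 - ((b * μ : ℝ) : ℂ) * w - ((c ^ 2 * μ / 2 : ℝ) : ℂ) * (w * w) := by
      rw [vgComplexBase]
      push_cast
      ring
    rw [h1, vgBase, Complex.sub_re, Complex.sub_re, Complex.re_ofReal_mul, Complex.re_ofReal_mul,
      Complex.mul_re, Complex.one_re]
    ring
  rw [h]
  have : 0 ≤ c ^ 2 * μ * w.im ^ 2 / 2 := by positivity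
  linarith

theorem vgLog_eq (b c μ : ℝ) (z : ℂ) :
    vgLog b c μ z = Complex.log (vgComplexBase b c μ (-Complex.I * z)) := by
  rw [vgLog, vgComplexBase]
  congr 1
  rw [mul_pow, neg_sq, Complex.I_sq]
  ring

theorem vgComplexBase_mem_slitPlane (hμ : 0 ≤ μ) {w : ℂ} (hw : 0 < vgBase b c μ w.re) :
    vgComplexBase b c μ w ∈ Complex.slitPlane :=
  Or.inl (hw.trans_le (vgBase_re_le hμ b c w))

theorem isOpen_vgBase_re_pos (b c μ : ℝ) : IsOpen {w : ℂ | 0 < vgBase b c μ w.re} :=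
  isOpen_lt continuous_const ((continuous_vgBase b c μ).comp Complex.continuous_re)

theorem analyticOnNhd_log_vgComplexBase (hμ : 0 ≤ μ) (b c : ℝ) :
    AnalyticOnNhd ℂ (fun w => Complex.log (vgComplexBase b c μ w))
      {w | 0 < vgBase b c μ w.re} := by
  refine DifferentiableOn.analyticOnNhd ?_ (isOpen_vgBase_re_pos b c μ)
  refine DifferentiableOn.clog ?_ fun w hw => vgComplexBase_mem_slitPlane hμ hw
  unfold vgComplexBase
  fun_prop

theorem isPreconnected_vgBase_re_pos (hμ : 0 ≤ μ) (b c : ℝ) :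
    IsPreconnected {w : ℂ | 0 < vgBase b c μ w.re} :=
  ((convex_vgBase_pos hμ b c).linear_preimage Complex.reLm).isPreconnected

end Base

/-! ### Generalized characteristic function of Variance Gamma increments -/

namespace IsVarianceGamma

variable {Ω : Type*} {m : MeasurableSpace Ω} {F : Filtration ℝ≥0 m} {X : ℝ≥0 → Ω → ℝ}
  {Q : Measure Ω} {b c μ ρ : ℝ} {s u : ℝ≥0}

theorem measurable (hX : IsVarianceGamma F X b c μ Q) (s : ℝ≥0) : Measurable (X s) :=
  (hX.adapted s).measurable.mono (F.le s) le_rfl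

theorem lintegral_exp_increment [IsProbabilityMeasure Q] (hX : IsVarianceGamma F X b c μ Q)
    (hμ : 0 < μ) (hsu : s ≤ u) (hρ : 0 < vgBase b c μ ρ) :
    ∫⁻ ω, ENNReal.ofReal (Real.exp (ρ * (X u ω - X s ω))) ∂Q =
      ENNReal.ofReal (Real.exp (-(((u : ℝ) - s) / μ) * Real.log (vgBase b c μ ρ))) := by
  obtain ⟨Y, W, hY, hWm, hW, hind, hsub⟩ := hX.subordination
  have hbase : vgBase b c μ ρ = 1 - μ * (b * ρ + (c * ρ) ^ 2 / 2) := by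
    rw [vgBase]
    ring
  rw [hbase] at hρ ⊢
  rw [← lintegral_exp_subordinated hY hWm hW hind hμ hsu _ _ hρ]
  refine lintegral_congr_ae ?_
  filter_upwards [hsub] with ω hω
  rw [hω, hω]
  ring_nf

theorem integrable_exp_increment [IsProbabilityMeasure Q] (hX : IsVarianceGamma F X b c μ Q)
    (hμ : 0 < μ) (hsu : s ≤ u) (hρ : 0 < vgBase b c μ ρ) :
    Integrable (fun ω => Real.exp (ρ * (X u ω - X s ω))) Q := by
  have hm := ((((hX.measurable u).sub (hX.measurable s)).const_mul ρ).exp).aestronglyMeasurable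
    (μ := Q)
  refine (lintegral_ofReal_ne_top_iff_integrable hm
    (ae_of_all _ fun ω => (Real.exp_pos _).le)).1 ?_
  simp only [Pi.sub_apply, hX.lintegral_exp_increment hμ hsu hρ]
  exact ENNReal.ofReal_ne_top

theorem mgf_increment [IsProbabilityMeasure Q] (hX : IsVarianceGamma F X b c μ Q)
    (hμ : 0 < μ) (hsu : s ≤ u) (hρ : 0 < vgBase b c μ ρ) :
    mgf (fun ω => X u ω - X s ω) Q ρ =
      Real.exp (-(((u : ℝ) - s) / μ) * Real.log (vgBase b c μ ρ)) := by
  rw [mgf, integral_eq_lintegral_of_nonneg_ae (ae_of_all _ fun ω => (Real.exp_pos _).le)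
    (hX.integrable_exp_increment hμ hsu hρ).aestronglyMeasurable,
    hX.lintegral_exp_increment hμ hsu hρ, ENNReal.toReal_ofReal (Real.exp_pos _).le]

/-- Both sides are analytic on the connected strip where the base at `Re w` is positive, and they
agree at real points accumulating at `0`; the identity theorem does the rest. -/
theorem complexMGF_increment [IsProbabilityMeasure Q] (hX : IsVarianceGamma F X b c μ Q)
    (hμ : 0 < μ) (hsu : s ≤ u) {w : ℂ} (hw : 0 < vgBase b c μ w.re) :
    complexMGF (fun ω => X u ω - X s ω) Q w =
      Complex.exp (-(((u : ℂ) - s) / μ) * Complex.log (vgComplexBase b c μ w)) := by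
  have hsubset : {ρ | 0 < vgBase b c μ ρ} ⊆
      interior (integrableExpSet (fun ω => X u ω - X s ω) Q) :=
    interior_maximal (fun ρ hρ => hX.integrable_exp_increment hμ hsu hρ)
      (isOpen_lt continuous_const (continuous_vgBase b c μ))
  have h1 : AnalyticOnNhd ℂ (complexMGF (fun ω => X u ω - X s ω) Q)
      {w | 0 < vgBase b c μ w.re} :=
    analyticOnNhd_complexMGF.mono fun w hw => hsubset hw
  have h2 : AnalyticOnNhd ℂ (fun w => Complex.exp (-(((u : ℂ) - s) / μ) *
      Complex.log (vgComplexBase b c μ w))) {w | 0 < vgBase b c μ w.re} :=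
    (analyticOnNhd_const.mul (analyticOnNhd_log_vgComplexBase hμ.le b c)).cexp
  refine h1.eqOn_of_preconnected_of_frequently_eq h2 (isPreconnected_vgBase_re_pos hμ.le b c)
    (z₀ := ((0 : ℝ) : ℂ)) (by simp [vgBase_zero]) ?_ hw
  have h3 : ∀ᶠ x : ℝ in 𝓝[≠] 0, 0 < vgBase b c μ x := by
    refine ((continuous_vgBase b c μ).continuousAt.eventually_const_lt ?_).filter_mono
      nhdsWithin_le_nhds
    rw [vgBase_zero]
    exact one_pos
  have h4 : Tendsto (fun x : ℝ => (x : ℂ)) (𝓝[≠] 0) (𝓝[≠] ((0 : ℝ) : ℂ)) :=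
    tendsto_nhdsWithin_of_tendsto_nhds_of_eventually_within _
      (Complex.continuous_ofReal.continuousAt.tendsto.mono_left nhdsWithin_le_nhds)
      (eventually_nhdsWithin_of_forall fun x hx => by simpa using hx)
  refine h4.frequently (h3.mono fun x hx => ?_).frequently
  rw [complexMGF_ofReal, hX.mgf_increment hμ hsu hx, vgComplexBase_ofReal,
    ← Complex.ofReal_log hx.le]
  push_cast
  rfl

theorem genCharFun_increment [IsProbabilityMeasure Q] (hX : IsVarianceGamma F X b c μ Q)
    (hμ : 0 < μ) (hsu : s ≤ u) {z : ℂ} (hz : 0 < vgBase b c μ z.im) :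
    genCharFun Q (fun ω => X u ω - X s ω) (-z) =
      Complex.exp (-(1 / (μ : ℂ)) * ((u : ℂ) - (s : ℂ)) * vgLog b c μ z) := by
  have hre : (-Complex.I * z).re = z.im := by simp
  have h := hX.complexMGF_increment hμ hsu (w := -Complex.I * z) (by rwa [hre])
  have h1 : genCharFun Q (fun ω => X u ω - X s ω) (-z) =
      complexMGF (fun ω => X u ω - X s ω) Q (-Complex.I * z) := by
    rw [genCharFun, complexMGF]
    refine integral_congr_ae (ae_of_all _ fun ω => ?_)
    simp only
    ring_nf
  rw [h1, h, vgLog_eq]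
  ring_nf

end IsVarianceGamma

/-! ### The Variance Gamma model as an exponential model -/

namespace IsVarianceGamma

variable {Ω : Type*} {m : MeasurableSpace Ω} {F : Filtration ℝ≥0 m} {X S : ℝ≥0 → Ω → ℝ}
  {Q : Measure Ω} {b c μ ν r d : ℝ} {T : ℝ≥0}

theorem ae_right_cont (hX : IsVarianceGamma F X b c μ Q) :
    ∀ᵐ ω ∂Q, ∀ s, ContinuousWithinAt (fun s => X s ω) (Set.Ici s) s := by
  obtain ⟨Y, W, hY, -, hW, -, hsub⟩ := hX.subordination
  filter_upwards [hY.cadlag, hW.cont, hsub] with ω h1 h2 h3 s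
  simp only [h3]
  have hYc : ContinuousWithinAt (fun s => Y s ω) (Set.Ici s) s :=
    NNReal.isEmbedding_coe.continuousWithinAt_iff.2 (h1 s).1
  exact ((h1 s).1.const_mul b).add
    ((h2.continuousAt.comp_continuousWithinAt hYc).const_mul c)

theorem integral_exp_increment [IsProbabilityMeasure Q] (hX : IsVarianceGamma F X b c μ Q)
    (hμ : 0 < μ) {s u : ℝ≥0} (hsu : s ≤ u) {ρ : ℝ} (hρ : 0 < vgBase b c μ ρ) :
    ∫ ω, Real.exp (ρ * (X u ω - X s ω)) ∂Q =
      Real.exp (-(((u : ℝ) - s) / μ) * Real.log (vgBase b c μ ρ)) :=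
  hX.mgf_increment hμ hsu hρ

/-- The Variance Gamma driver with martingale drift defines an exponential model. -/
theorem isExpModel [IsProbabilityMeasure Q] (hX : IsVarianceGamma F X b c μ Q) (hμ : 0 < μ)
    (hν : 1 < ν) (hbase : 0 < vgBase b c μ ν) (hS : IsExpPrice F X (r + vgOmega b c μ) S Q) :
    IsExpModel F (fun (s : ℝ≥0) ω => vgOmega b c μ * (s : ℝ) + X s ω) r S Q T ν
      (Real.exp (T * (|ν * vgOmega b c μ| + |Real.log (vgBase b c μ ν) / μ|))) := by
  have hone : 0 < vgBase b c μ 1 := vgBase_pos_of_le hμ.le hbase zero_le_one hν.le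
  have hinc : ∀ (ρ : ℝ) (s u : ℝ≥0) (ω : Ω),
      Real.exp (ρ * (vgOmega b c μ * (u : ℝ) + X u ω - (vgOmega b c μ * (s : ℝ) + X s ω))) =
        Real.exp (ρ * vgOmega b c μ * ((u : ℝ) - s)) * Real.exp (ρ * (X u ω - X s ω)) := by
    intro ρ s u ω
    rw [← Real.exp_add]
    ring_nf
  have hint : ∀ (ρ : ℝ) (s u : ℝ≥0), s ≤ u → 0 < vgBase b c μ ρ → Integrable (fun ω =>
      Real.exp (ρ * (vgOmega b c μ * (u : ℝ) + X u ω - (vgOmega b c μ * (s : ℝ) + X s ω)))) Q := by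
    intro ρ s u hsu hρ
    simp only [hinc]
    exact (hX.integrable_exp_increment hμ hsu hρ).const_mul _
  have hval : ∀ (ρ : ℝ) (s u : ℝ≥0), s ≤ u → 0 < vgBase b c μ ρ → ∫ ω,
      Real.exp (ρ * (vgOmega b c μ * (u : ℝ) + X u ω - (vgOmega b c μ * (s : ℝ) + X s ω))) ∂Q =
      Real.exp (((u : ℝ) - s) * (ρ * vgOmega b c μ - Real.log (vgBase b c μ ρ) / μ)) := by
    intro ρ s u hsu hρ
    simp only [hinc]
    rw [integral_const_mul, hX.integral_exp_increment hμ hsu hρ, ← Real.exp_add]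
    ring_nf
  exact
    { adapted := hS.adapted
      pos := hS.pos
      integrable := hS.integrable
      dynamics := by
        filter_upwards [hS.dynamics] with ω hω s u hsu
        rw [hω s u hsu]
        ring_nf
      adapted_driver := fun s => stronglyMeasurable_const.add (hX.adapted s)
      indep := by
        intro s u hsu
        refine indep_of_indep_of_le_left (hX.indep s u hsu) ?_
        have h : (fun ω => vgOmega b c μ * (u : ℝ) + X u ω - (vgOmega b c μ * (s : ℝ) + X s ω)) =
            (fun x => vgOmega b c μ * ((u : ℝ) - s) + x) ∘ fun ω => X u ω - X s ω := by
          ext ω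
          simp only [Function.comp]
          ring
        rw [h, ← MeasurableSpace.comap_comp]
        exact MeasurableSpace.comap_mono (measurable_id.const_add _).comap_le
      right_cont := by
        filter_upwards [hX.ae_right_cont] with ω hω s
        exact (Continuous.continuousWithinAt (by fun_prop)).add (hω s)
      integrable_exp := fun s u hsu _ => by simpa using hint 1 s u hsu hone
      integral_exp := fun s u hsu _ => by
        have h := hval 1 s u hsu hone
        simp only [one_mul] at h
        rw [h, vgOmega_eq]
        simp [div_eq_inv_mul]
      integrable_exp_mul := fun u hu => hint ν u T hu hbase
      integral_exp_mul_le := fun u hu => by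
        rw [hval ν u T hu hbase, Real.exp_le_exp]
        have hu' : (u : ℝ) ≤ T := hu
        have h1 := le_abs_self (ν * vgOmega b c μ)
        have h2 := neg_abs_le (Real.log (vgBase b c μ ν) / μ)
        exact (mul_le_mul_of_nonneg_left (by linarith) (sub_nonneg.2 hu')).trans
          (mul_le_mul_of_nonneg_right (by linarith [u.coe_nonneg]) (by positivity)) }

end IsVarianceGamma

/-! ### The inner time integral -/

section Exponent

variable {r b c μ ν lam : ℝ} {t T : ℝ≥0}

theorem analyticOnNhd_vgExponent (hμ : 0 ≤ μ) (r b c lam : ℝ) :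
    AnalyticOnNhd ℂ (vgExponent r b c μ lam) {z | 0 < vgBase b c μ z.im} := by
  have hmaps : Set.MapsTo (fun z => -Complex.I * z) {z : ℂ | 0 < vgBase b c μ z.im}
      {w | 0 < vgBase b c μ w.re} := fun z hz => by simpa using hz
  have hlog : AnalyticOnNhd ℂ (vgLog b c μ) {z | 0 < vgBase b c μ z.im} := by
    have h : vgLog b c μ = (fun w => Complex.log (vgComplexBase b c μ w)) ∘
        fun z => -Complex.I * z := by
      ext z
      exact vgLog_eq b c μ z
    rw [h]
    exact (analyticOnNhd_log_vgComplexBase hμ b c).comp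
      (analyticOnNhd_const.mul analyticOnNhd_id) hmaps
  unfold vgExponent
  refine AnalyticOnNhd.sub (AnalyticOnNhd.add (AnalyticOnNhd.add ?_ ?_)
    (analyticOnNhd_const.mul hlog)) analyticOnNhd_const
  · exact analyticOnNhd_const.mul (analyticOnNhd_const.add
      (analyticOnNhd_const.mul analyticOnNhd_id))
  · exact analyticOnNhd_const.mul analyticOnNhd_id

/-- At `z = i` the interest term vanishes and the correction cancels the logarithm. For `lam ≠ 0`
this shows that the exponent is not identically zero. -/
theorem vgExponent_I (hbase : 0 < vgBase b c μ 1) (r lam : ℝ) :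
    vgExponent r b c μ lam Complex.I = -lam := by
  have h1 : -Complex.I * Complex.I = ((1 : ℝ) : ℂ) := by simp
  have h2 : (vgOmega b c μ : ℂ) = 1 / μ * vgLog b c μ Complex.I := by
    rw [vgLog_eq, h1, vgComplexBase_ofReal, ← Complex.ofReal_log hbase.le, vgOmega_eq]
    push_cast
    rfl
  rw [vgExponent, ← h2, mul_right_comm Complex.I, Complex.I_mul_I]
  ring

/-- The strip containing the contour also contains `i`, where the exponent is nonzero. Its zeros are
therefore isolated, and those on the contour form a null set. -/
theorem ae_vgExponent_ne_zero (hμ : 0 < μ) (hν : 1 < ν) (hbase : 0 < vgBase b c μ ν)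
    (hlam : lam ≠ 0) (r : ℝ) : ∀ᵐ x : ℝ, vgExponent r b c μ lam ((x : ℂ) + ν * Complex.I) ≠ 0 := by
  have hone : 0 < vgBase b c μ 1 := vgBase_pos_of_le hμ.le hbase zero_le_one hν.le
  have hA := analyticOnNhd_vgExponent hμ.le r b c lam
  have hpre : IsPreconnected {z : ℂ | 0 < vgBase b c μ z.im} :=
    ((convex_vgBase_pos hμ.le b c).linear_preimage Complex.imLm).isPreconnected
  have hev : ∀ x : ℝ, ∀ᶠ y : ℝ in 𝓝[≠] x,
      vgExponent r b c μ lam ((y : ℂ) + ν * Complex.I) ≠ 0 := by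
    intro x
    have hmem : (x : ℂ) + ν * Complex.I ∈ {z : ℂ | 0 < vgBase b c μ z.im} := by
      simpa using hbase
    have h1 : ∀ᶠ z in 𝓝[≠] ((x : ℂ) + ν * Complex.I), vgExponent r b c μ lam z ≠ 0 := by
      by_contra h
      rw [not_eventually] at h
      have h0 := hA.eqOn_zero_of_preconnected_of_frequently_eq_zero hpre hmem
        (h.mono fun z hz => not_not.1 hz)
        (show Complex.I ∈ {z : ℂ | 0 < vgBase b c μ z.im} by simpa using hone)
      rw [vgExponent_I hone] at h0
      exact hlam (by simpa using h0)
    have hc : Continuous fun y : ℝ => (y : ℂ) + ν * Complex.I := by fun_prop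
    refine (tendsto_nhdsWithin_of_tendsto_nhds_of_eventually_within _
      (hc.continuousAt.tendsto.mono_left nhdsWithin_le_nhds)
      (eventually_nhdsWithin_of_forall fun y hy => ?_)).eventually h1
    simpa using hy
  have hcod : {x : ℝ | vgExponent r b c μ lam ((x : ℂ) + ν * Complex.I) ≠ 0} ∈ codiscrete ℝ := by
    rw [mem_codiscrete]
    intro x
    rw [disjoint_principal_right, compl_compl]
    exact hev x
  have := ae_restrict_le_codiscreteWithin (μ := (volume : Measure ℝ)) MeasurableSet.univ hcod
  rwa [Measure.restrict_univ] at this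

theorem neg_le_re_vgExponent (hμ : 0 < μ) (hbase : 0 < vgBase b c μ ν) {z : ℂ} (hz : z.im = ν) :
    r * (1 - ν) - vgOmega b c μ * ν + 1 / μ * Real.log (vgBase b c μ ν) - lam ≤
      (vgExponent r b c μ lam z).re := by
  have hre : (-Complex.I * z).re = ν := by simp [hz]
  have h1 : Real.log (vgBase b c μ ν) ≤ (vgLog b c μ z).re := by
    rw [vgLog_eq, Complex.log_re]
    refine Real.log_le_log hbase ?_
    have := vgBase_re_le hμ.le b c (-Complex.I * z)
    rw [hre] at this
    exact this.trans (Complex.re_le_norm _)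
  have h2 : (vgExponent r b c μ lam z).re =
      r * (1 - ν) - vgOmega b c μ * ν + 1 / μ * (vgLog b c μ z).re - lam := by
    have h3 : vgExponent r b c μ lam z = ((r : ℝ) : ℂ) * (1 + Complex.I * z) +
        ((vgOmega b c μ : ℝ) : ℂ) * (Complex.I * z) + ((1 / μ : ℝ) : ℂ) * vgLog b c μ z
          - (lam : ℝ) := by
      rw [vgExponent]
      push_cast
      ring
    rw [h3, Complex.sub_re, Complex.add_re, Complex.add_re, Complex.re_ofReal_mul,
      Complex.re_ofReal_mul, Complex.re_ofReal_mul, Complex.ofReal_re]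
    simp [hz]
    ring
  rw [h2]
  have := mul_le_mul_of_nonneg_left h1 (by positivity : 0 ≤ 1 / μ)
  linarith

/-- For `A ≠ 0` the quotient is `∫₀ʰ exp (-A u) du`, so it stays bounded as `A` approaches zero; at
`A = 0` it is zero by convention. -/
theorem norm_one_sub_exp_div_le {A : ℂ} {K h : ℝ} (hK : 0 ≤ K) (hh : 0 ≤ h) (hA : -K ≤ A.re) :
    ‖(1 - Complex.exp (-A * h)) / A‖ ≤ h * Real.exp (K * h) := by
  rcases eq_or_ne A 0 with rfl | hA0
  · simp
    positivity
  have h1 : (1 - Complex.exp (-A * h)) / A = ∫ u in (0 : ℝ)..h, Complex.exp (-A * u) := by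
    rw [integral_exp_mul_complex (neg_ne_zero.2 hA0)]
    simp only [Complex.ofReal_zero, mul_zero, Complex.exp_zero]
    rw [div_neg, ← neg_div, neg_sub]
  rw [h1]
  have h2 := intervalIntegral.norm_integral_le_of_norm_le_const (a := 0) (b := h)
    (f := fun u : ℝ => Complex.exp (-A * u)) (C := Real.exp (K * h)) fun u hu => by
      rw [Set.uIoc_of_le hh] at hu
      rw [Complex.norm_exp, Real.exp_le_exp, Complex.re_mul_ofReal, Complex.neg_re]
      exact mul_le_mul (by linarith) hu.2 hu.1.le hK
  rwa [sub_zero, abs_of_nonneg hh, mul_comm] at h2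

theorem lineIntegrable_vgKernel (hμ : 0 < μ) (hν : 1 < ν) (hbase : 0 < vgBase b c μ ν)
    (htT : t ≤ T) (r lam : ℝ) : LineIntegrable ν (vgKernel r b c μ lam t T) := by
  have hmem : ∀ x : ℝ, (x : ℂ) + ν * Complex.I ∈ {z : ℂ | 0 < vgBase b c μ z.im} := fun x => by
    simpa using hbase
  have hA : Continuous fun x : ℝ => vgExponent r b c μ lam ((x : ℂ) + ν * Complex.I) :=
    (analyticOnNhd_vgExponent hμ.le r b c lam).continuousOn.comp_continuous (by fun_prop) hmem
  -- Minus the uniform lower bound of `Re A` on the contour, cut off at zero to be nonnegative.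
  set K := max (-(r * (1 - ν) - vgOmega b c μ * ν + 1 / μ * Real.log (vgBase b c μ ν) - lam)) 0
  refine lineIntegrable_inv_fourier_denominator_mul hν
    (f := fun z => (1 - Complex.exp (-vgExponent r b c μ lam z * ((T : ℂ) - (t : ℂ)))) /
      vgExponent r b c μ lam z) (C := ((T : ℝ) - t) * Real.exp (K * ((T : ℝ) - t))) ?_ fun x => ?_
  · have h1 : Measurable fun x : ℝ => vgExponent r b c μ lam ((x : ℂ) + ν * Complex.I) :=
      hA.measurable
    exact Measurable.aestronglyMeasurable (by fun_prop)
  · have h1 := neg_le_re_vgExponent (r := r) (lam := lam) hμ hbase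
      (z := (x : ℂ) + ν * Complex.I) (by simp)
    have h2 := norm_one_sub_exp_div_le (A := vgExponent r b c μ lam ((x : ℂ) + ν * Complex.I))
      (K := K) (h := (T : ℝ) - t) (le_max_right _ _) (sub_nonneg.2 htT)
      (le_trans (neg_le.1 (le_max_left _ _)) h1)
    simpa using h2

end Exponent

namespace IsVarianceGamma

variable {Ω : Type*} {m : MeasurableSpace Ω} {F : Filtration ℝ≥0 m} {X S : ℝ≥0 → Ω → ℝ}
  {Q : Measure Ω} {r b c μ ν lam : ℝ} {t T : ℝ≥0} {τ : Ω → WithTop ℝ≥0}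
  {hτ : ∀ s : ℝ≥0, MeasurableSet[m] {ω | τ ω ≤ (s : WithTop ℝ≥0)}}

/-- All exponents are affine in `u` and combine to `-A(z) (T - u) - lam (T - t)`; the subtraction of
`lam` in `A` compensates the survival factor. -/
theorem timeIntegrand_eq [IsProbabilityMeasure Q] (hX : IsVarianceGamma F X b c μ Q) (hμ : 0 < μ)
    (hbase : 0 < vgBase b c μ ν) {z : ℂ} (hz : z.im = ν) {u : ℝ} (hu : u ∈ Set.Icc (t : ℝ) T) :
    timeIntegrand Q (fun (s : ℝ≥0) ω => vgOmega b c μ * (s : ℝ) + X s ω) r (fun _ => lam) t T z u =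
      lam * Complex.exp (lam * t - lam * T) *
        (Complex.exp (-vgExponent r b c μ lam z * T) * Complex.exp (vgExponent r b c μ lam z * u))
          := by
  have hu0 : ((u.toNNReal : ℝ≥0) : ℝ) = u := Real.coe_toNNReal u (t.coe_nonneg.trans hu.1)
  have hu0' : ((u.toNNReal : ℝ≥0) : ℂ) = (u : ℂ) := congrArg Complex.ofReal hu0
  have huT : u.toNNReal ≤ T := Real.toNNReal_le_iff_le_coe.2 hu.2
  have h1 : genCharFun Q (fun ω => vgOmega b c μ * (T : ℝ) + X T ω -
        (vgOmega b c μ * ((u.toNNReal : ℝ≥0) : ℝ) + X u.toNNReal ω)) (-z) =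
      Complex.exp (-Complex.I * z * (vgOmega b c μ * ((T : ℂ) - u))) *
        Complex.exp (-(1 / (μ : ℂ)) * ((T : ℂ) - u) * vgLog b c μ z) := by
    rw [← hu0', ← hX.genCharFun_increment hμ huT (by rwa [hz]), genCharFun, genCharFun,
      ← integral_const_mul]
    refine integral_congr_ae (ae_of_all _ fun ω => ?_)
    simp only
    rw [← Complex.exp_add]
    push_cast
    ring_nf
  rw [timeIntegrand, h1, intervalIntegral.integral_const, smul_eq_mul, Complex.ofReal_mul,
    Complex.ofReal_exp, mul_left_comm, mul_assoc (lam : ℂ)]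
  simp only [← Complex.exp_add, vgExponent]
  congr 2
  push_cast
  ring

theorem integral_timeIntegrand [IsProbabilityMeasure Q] (hX : IsVarianceGamma F X b c μ Q)
    (hμ : 0 < μ) (hbase : 0 < vgBase b c μ ν) (htT : t ≤ T) {z : ℂ} (hz : z.im = ν)
    (hA : vgExponent r b c μ lam z ≠ 0) :
    (∫ u in (t : ℝ)..T, timeIntegrand Q
        (fun (s : ℝ≥0) ω => vgOmega b c μ * (s : ℝ) + X s ω) r (fun _ => lam) t T z u) =
      lam * Complex.exp (-(lam : ℂ) * ((T : ℂ) - (t : ℂ))) *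
        ((1 - Complex.exp (-vgExponent r b c μ lam z * ((T : ℂ) - (t : ℂ)))) /
          vgExponent r b c μ lam z) := by
  have htT' : (t : ℝ) ≤ T := htT
  rw [intervalIntegral.integral_congr fun u hu =>
    hX.timeIntegrand_eq hμ hbase hz (by rwa [Set.uIcc_of_le htT'] at hu)]
  rw [intervalIntegral.integral_const_mul, intervalIntegral.integral_const_mul,
    integral_exp_mul_complex hA, mul_div_assoc', mul_sub, ← Complex.exp_add, ← Complex.exp_add]
  congr 2
  · ring_nf
  · simp
    ring_nf

/-- If `lam = 0` both sides are zero. Otherwise the closed form holds almost everywhere on the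
contour, so the conventional value at zeros of `A` has no effect. -/
theorem lineIntegral_timeIntegral [IsProbabilityMeasure Q] (hX : IsVarianceGamma F X b c μ Q)
    (hμ : 0 < μ) (hν : 1 < ν) (hbase : 0 < vgBase b c μ ν) (htT : t ≤ T) :
    lineIntegral ν (fun z => 1 / (Complex.I * z - z ^ 2) * ∫ u in (t : ℝ)..T, timeIntegrand Q
        (fun (s : ℝ≥0) ω => vgOmega b c μ * (s : ℝ) + X s ω) r (fun _ => lam) t T z u) =
      lam * Complex.exp (-(lam : ℂ) * ((T : ℂ) - (t : ℂ))) *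
        lineIntegral ν (vgKernel r b c μ lam t T) := by
  rcases eq_or_ne lam 0 with rfl | hlam
  · simp [lineIntegral, timeIntegrand]
  rw [lineIntegral, lineIntegral, ← integral_const_mul]
  refine integral_congr_ae ?_
  filter_upwards [ae_vgExponent_ne_zero hμ hν hbase hlam r] with x hx
  rw [hX.integral_timeIntegrand hμ hbase htT (by simp) hx, vgKernel, mul_left_comm]

theorem rtfsPrice_ae_eq [IsProbabilityMeasure Q] (hX : IsVarianceGamma F X b c μ Q)
    (hμ : 0 < μ) (hν : 1 < ν) (hbase : 0 < vgBase b c μ ν) (htT : t ≤ T)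
    (hS : IsExpPrice F X (r + vgOmega b c μ) S Q) (hIND : IND F τ hτ Q)
    (hlam : HasHazardRate τ (fun _ => lam) Q) :
    ∀ᵐ ω ∂Q, (rtfsPrice Q (enlarged F τ hτ) r S τ 1 t T ω : ℂ) =
      (fixedStrikePart Q (enlarged F τ hτ) r S τ t T ω : ℂ) +
        {ω | (t : WithTop ℝ≥0) < τ ω}.indicator (fun ω =>
          ((S t ω / (2 * Real.pi) * lam * Real.exp (-lam * ((T : ℝ) - t)) : ℝ) : ℂ) *
            lineIntegral ν (vgKernel r b c μ lam t T)) ω := by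
  filter_upwards [(hX.isExpModel hμ hν hbase hS).rtfsPrice_ae_eq_lineIntegral hν htT hIND hlam]
    with ω hω
  rw [hω, hX.lineIntegral_timeIntegral hμ hν hbase htT]
  congr 1
  refine congrFun (congrArg _ (funext fun ω => ?_)) ω
  push_cast
  ring

end IsVarianceGamma

end RTFS

/-! ### The pricing formulas for both models -/

theorem mainTheorem3 {Ω : Type*} {m : MeasurableSpace Ω} (Q : Measure Ω) [IsProbabilityMeasure Q]
    (F : Filtration ℝ≥0 m) (τ : Ω → WithTop ℝ≥0)
    (hτ : ∀ s : ℝ≥0, MeasurableSet[m] {ω | τ ω ≤ (s : WithTop ℝ≥0)})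
    (hIND : IND F τ hτ Q)
    (X S : ℝ≥0 → Ω → ℝ) (r ν : ℝ) (hν : 1 < ν) (t T : ℝ≥0) (htT : t ≤ T) :
    -- General exponential Lévy dynamics, deterministic hazard rate.
    (∀ lam : ℝ → ℝ, HasHazardRate τ lam Q →
      IsLevyProcess F X Q → IsExpPrice F X r S Q →
      Martingale (fun (s : ℝ≥0) ω => Real.exp (-r * (s : ℝ)) * S s ω) F Q →
      Integrable (fun ω => Real.exp (ν * X T ω)) Q →
      (∀ u, u ≤ T → Integrable (fun ω => Real.exp (ν * (X T ω - X u ω))) Q) ∧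
      (∀ u, u ≤ T → ∀ y, LineIntegrable ν (callKernel Q (fun ω => X T ω - X u ω) y)) ∧
      -- Fourier representation of the call price.
      (∀ u, u ≤ T → ∀ K, 0 < K → ∀ᵐ ω ∂Q,
        (callPrice Q F r S K u T ω : ℂ) =
          ((Real.exp (-r * ((T : ℝ) - u)) * K / (2 * Real.pi) : ℝ) : ℂ) *
            lineIntegral ν (callKernel Q (fun ω => X T ω - X u ω)
              (Real.log (S u ω / K) + r * ((T : ℝ) - u)))) ∧
      -- Fourier representation of the forward-start price.
      (∀ u, t ≤ u → u ≤ T → ∀ α, 0 < α → ∀ᵐ ω ∂Q,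
        (forwardStartPrice Q F r S α t u T ω : ℂ) =
          ((S t ω * Real.exp (-r * ((T : ℝ) - u)) * α / (2 * Real.pi) : ℝ) : ℂ) *
            lineIntegral ν (callKernel Q (fun ω => X T ω - X u ω)
              (-Real.log α + r * ((T : ℝ) - u)))) ∧
      -- Double integral formula for the random time forward-start price with `α = 1`.
      Integrable (rtfsPayoff r S τ 1 t T) Q ∧ Integrable (fixedPayoff r S τ t T) Q ∧
      (∀ x : ℝ, IntervalIntegrable
        (timeIntegrand Q X r lam t T ((x : ℂ) + (ν : ℂ) * Complex.I)) volume t T) ∧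
      LineIntegrable ν (fun z => 1 / (Complex.I * z - z ^ 2) *
        ∫ u in (t : ℝ)..T, timeIntegrand Q X r lam t T z u) ∧
      (∀ᵐ ω ∂Q, (rtfsPrice Q (enlarged F τ hτ) r S τ 1 t T ω : ℂ) =
        (fixedStrikePart Q (enlarged F τ hτ) r S τ t T ω : ℂ) +
        {ω | (t : WithTop ℝ≥0) < τ ω}.indicator (fun ω =>
          ((S t ω / (2 * Real.pi) : ℝ) : ℂ) *
            lineIntegral ν (fun z => 1 / (Complex.I * z - z ^ 2) *
              ∫ u in (t : ℝ)..T, timeIntegrand Q X r lam t T z u)) ω)) ∧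
    -- Variance Gamma dynamics, constant hazard rate.
    (∀ lam b c μ : ℝ, 0 < μ → 0 < 1 - b * μ * ν - c ^ 2 * μ * ν ^ 2 / 2 →
      HasHazardRate τ (fun _ => lam) Q →
      IsVarianceGamma F X b c μ Q → IsExpPrice F X (r + vgOmega b c μ) S Q →
      (∀ u, u ≤ T → Integrable (fun ω => Real.exp (ν * (X T ω - X u ω))) Q) ∧
      -- Characteristic function of the increments on the contour.
      (∀ u, u ≤ T → ∀ z : ℂ, z.im = ν →
        genCharFun Q (fun ω => X T ω - X u ω) (-z) =
          Complex.exp (-(1 / (μ : ℂ)) * ((T : ℂ) - (u : ℂ)) * vgLog b c μ z)) ∧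
      -- Closed form of the inner time integral.
      (∀ z : ℂ, z.im = ν → vgExponent r b c μ lam z ≠ 0 →
        (∫ u in (t : ℝ)..T,
            timeIntegrand Q (fun (s : ℝ≥0) ω => vgOmega b c μ * (s : ℝ) + X s ω) r (fun _ => lam) t T z u) =
          lam * Complex.exp (-(lam : ℂ) * ((T : ℂ) - (t : ℂ))) *
            ((1 - Complex.exp (-vgExponent r b c μ lam z * ((T : ℂ) - (t : ℂ)))) /
              vgExponent r b c μ lam z)) ∧
      -- Single contour integral formula.
      Integrable (rtfsPayoff r S τ 1 t T) Q ∧ Integrable (fixedPayoff r S τ t T) Q ∧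
      LineIntegrable ν (vgKernel r b c μ lam t T) ∧
      (∀ᵐ ω ∂Q, (rtfsPrice Q (enlarged F τ hτ) r S τ 1 t T ω : ℂ) =
        (fixedStrikePart Q (enlarged F τ hτ) r S τ t T ω : ℂ) +
        {ω | (t : WithTop ℝ≥0) < τ ω}.indicator (fun ω =>
          ((S t ω / (2 * Real.pi) * lam * Real.exp (-lam * ((T : ℝ) - t)) : ℝ) : ℂ) *
            lineIntegral ν (vgKernel r b c μ lam t T)) ω)) := by
  refine ⟨fun lam hlam hX hS hM hint => ?_, fun lam b c μ hμ hbase hlam hX hS => ?_⟩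
  · have h := isExpModel_of_isLevyProcess hν hX hS hM hint
    have hτm := measurable_of_measurableSet_le hτ
    refine ⟨h.integrable_exp_mul, fun u hu y => lineIntegrable_callKernel hν (h.measurable_increment u T)
      y, fun u hu K hK => ?_, fun u htu hu α hα => ?_,
      h.integrable_rtfsPayoff hτm, h.integrable_fixedPayoff hτm,
      fun x => h.intervalIntegrable_timeIntegrand hν hlam htT x,
      h.lineIntegrable_timeIntegral hν hlam htT, h.rtfsPrice_ae_eq_lineIntegral hν htT hIND hlam⟩
    · filter_upwards [h.callPrice_ae_eq hu hK] with ω hω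
      rw [hω, Complex.ofReal_mul, h.ofReal_callValue_eq hν hu]
      push_cast
      ring
    · filter_upwards [h.forwardStartPrice_ae_eq htu hu hα] with ω hω
      rw [hω, ← mul_assoc, Complex.ofReal_mul, h.ofReal_callValue_eq hν hu]
      push_cast
      ring
  · have hbase' : 0 < vgBase b c μ ν := hbase
    have h := hX.isExpModel (T := T) hμ hν hbase' hS
    have hτm := measurable_of_measurableSet_le hτ
    exact ⟨fun u hu => hX.integrable_exp_increment hμ hu hbase',
      fun u hu z hz => hX.genCharFun_increment hμ hu (by rwa [hz]),
      fun z hz hA => hX.integral_timeIntegrand hμ hbase' htT hz hA,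
      h.integrable_rtfsPayoff hτm, h.integrable_fixedPayoff hτm,
      lineIntegrable_vgKernel hμ hν hbase' htT r lam,
      hX.rtfsPrice_ae_eq hμ hν hbase' htT hS hIND hlam⟩
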